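/- Let $\Omega=[0,1]^{\mathbb Z\times\mathbb N}$ (with $\mathbb N=\{1,2,\dots\}$ and the product Borel $\sigma$-field), and let $\mathbb P$ be a probability measure on $\Omega$, with expectation $\mathbb E$, such that for some integer $M\ge 0$: - (IID) the cookie stacks $\omega(z,\cdot)$, $z\in\mathbb Z$, are independent and identically distributed under $\mathbb P$; - (WEL) for every $z\in\mathbb Z$, $\mathbb P[\forall i\in\mathbb N:\ \omega(z,i)>0]>0$ and $\mathbb P[\forall i\in\mathbb N:\ \omega(z,i)<1]>0$; - (BD$_M$) $\mathbb P$-a.s., $\omega(z,i)=1/2$ for all $z\in\mathbb Z$ and all $i>M$. Let $\delta:=\mathbb E\big[\sum_{i\ge1}(2\omega(0,i)-1)\big]$. For $x\in\mathbb Z$ and $\omega\in\Omega$, let $(X_n)_{n\ge0}$ be under $P_{x,\omega}$ an excited random walk started at $x$ in the environment $\omega$, i.e. a $\mathbb Z$-valued process with $P_{x,\omega}[X_0=x]=1$ and, for all $n\ge0$, $$P_{x,\omega}[X_{n+1}=X_n+1\mid X_0,\dots,X_n]=\omega\big(X_n,\#\{i\le n: X_i=X_n\}\big),$$ $$P_{x,\omega}[X_{n+1}=X_n-1\mid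 X_0,\dots,X_n]=1-\omega\big(X_n,\#\{i\le n: X_i=X_n\}\big),$$ where $P_{x,\omega}$ depends measurably on $\omega$, and let $P_x[\cdot]=\mathbb E[P_{x,\omega}[\cdot]]$ be the averaged measure. Then for every $x\in\mathbb Z$: - if $|\delta|<1$, then $P_x$-a.s. $X_n=x$ for infinitely many $n$; - if $\delta>1$, then $P_x$-a.s. $X_n\to+\infty$ as $n\to\infty$; - if $\delta<-1$, then $P_x$-a.s. $X_n\to-\infty$ as $n\to\infty$. -/

import Mathlib

open MeasureTheory ProbabilityTheory Filter
open scoped ProbabilityTheory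

/-- Cookie environments on the integers, with the product Borel sigma-field. Cookies are numbered
from `0`: `ω z i` is the `(i + 1)`-th cookie at the site `z`, that is, the probability of stepping
from `z` to `z + 1` upon the `(i + 1)`-th visit to `z`. -/
abbrev CookieEnv : Type := ℤ → ℕ → unitInterval

/-- (IID): the cookie stacks at the different sites are independent and identically distributed. -/
def CookieIID (P : Measure CookieEnv) : Prop :=
  iIndepFun (fun (z : ℤ) (ω : CookieEnv) => ω z) P ∧
    ∀ z : ℤ, IdentDistrib (fun ω : CookieEnv => ω z) (fun ω : CookieEnv => ω 0) P P

/-- (WEL): weak ellipticity. -/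
def CookieWEL (P : Measure CookieEnv) : Prop :=
  ∀ z : ℤ, 0 < P {ω | ∀ i, 0 < (ω z i : ℝ)} ∧ 0 < P {ω | ∀ i, (ω z i : ℝ) < 1}

/-- (BD_M): almost surely, all cookies after the `M`-th one at each site are equal to `1 / 2`. -/
def CookieBD (M : ℕ) (P : Measure CookieEnv) : Prop :=
  ∀ᵐ ω ∂P, ∀ z : ℤ, ∀ i : ℕ, M ≤ i → (ω z i : ℝ) = 1 / 2

/-- The drift parameter: the expected total displacement caused by the cookies at one site.
Under `CookieBD M P` the series is almost surely a finite sum. -/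
noncomputable def cookieDrift (P : Measure CookieEnv) : ℝ :=
  ∫ ω, ∑' i : ℕ, (2 * (ω 0 i : ℝ) - 1) ∂P

/-- The sigma-field generated by `X 0, …, X n`. -/
@[reducible]
def pastSigma {Ω' : Type*} (X : ℕ → Ω' → ℤ) (n : ℕ) : MeasurableSpace Ω' :=
  ⨆ i ∈ Finset.range (n + 1), MeasurableSpace.comap (X i) inferInstance

/-- The number of visits to the current site `X n` strictly before time `n`. As cookies are numbered
from `0`, this is the number of the cookie used at time `n`. -/
def priorVisits {Ω' : Type*} (X : ℕ → Ω' → ℤ) (n : ℕ) (w : Ω') : ℕ :=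
  ((Finset.range n).filter fun i => X i w = X n w).card

/-- Under `μ` the process `X` is an excited random walk started at `x` in the environment `ω`. -/
structure IsExcitedRandomWalk {Ω' : Type*} [MeasurableSpace Ω'] (μ : Measure Ω')
    (ω : CookieEnv) (x : ℤ) (X : ℕ → Ω' → ℤ) : Prop where
  measurable : ∀ n, Measurable (X n)
  start : ∀ᵐ w ∂μ, X 0 w = x
  step_right : ∀ n, μ⟦{w | X (n + 1) w = X n w + 1} | pastSigma X n⟧
    =ᵐ[μ] fun w => (ω (X n w) (priorVisits X n w) : ℝ)
  step_left : ∀ n, μ⟦{w | X (n + 1) w = X n w - 1} | pastSigma X n⟧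
    =ᵐ[μ] fun w => 1 - (ω (X n w) (priorVisits X n w) : ℝ)

open scoped ENNReal

/-!
Once the cookies are turned into stacks of random arrows, the walk is deterministic, and if every
stack has infinitely many arrows in both directions, then the walk visits its starting point
infinitely often or tends to `+∞` or to `-∞`. To the right of the starting point, the numbers of
right steps from consecutive sites evolve as a branching process: a site with `n` left arrows used
has sent as many steps to the right as there are right arrows before its `n`-th left arrow. If the
walk tends to `+∞`, then the process survives from some initial size, and if the walk is recurrent,
then the process dies out from every initial size.

For fair arrows the generating function of the offspring law maps `1 - 1 / u` to `1 - 1 / (u + 1)`.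
The cookies perturb this by a relative error `-δ / u`, uniformly in the size of the generation.
* If `δ > 1`, take `1 < b < δ`. The mixture of the functions `n ↦ (1 - 1 / u) ^ n` with the weights
  `u ^ (-b)` is a supersolution for large `n` which tends to `0`, so a large initial generation
  survives with probability close to `1`.
* If `δ < 1`, the mixture of the functions `n ↦ 1 - (1 - 1 / u) ^ n` with the weights `1 / u` is a
  supersolution for large `n` which grows like `log n`, so the process returns to a bounded set of
  sizes, from which it dies out by ellipticity.

The left side of the starting point is treated by reflection.
-/

/-! ### Walks following stacks of arrows -/

/-- The number of visits of the path `w` to the site `z` strictly before time `n`. -/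
def visits (w : ℕ → ℤ) (n : ℕ) (z : ℤ) : ℕ := Nat.count (fun i => w i = z) n

/-- The displacement caused by an arrow; `true` is an arrow to the right. -/
def arrowSign (b : Bool) : ℤ := if b then 1 else -1

/-- The path `w` starts at `x` and, at each visit to a site, follows the next unused arrow of the
stack of arrows at that site. -/
structure IsStackWalk (η : ℤ → ℕ → Bool) (x : ℤ) (w : ℕ → ℤ) : Prop where
  start : w 0 = x
  step : ∀ n, w (n + 1) = w n + arrowSign (η (w n) (visits w n (w n)))

/-- The number of right arrows among the first `t` arrows of a stack. -/
def rights (s : ℕ → Bool) (t : ℕ) : ℕ := Nat.count (fun i => s i = true) t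

/-- The number of left arrows among the first `t` arrows of a stack. -/
def lefts (s : ℕ → Bool) (t : ℕ) : ℕ := Nat.count (fun i => s i = false) t

/-- The stack contains infinitely many arrows in both directions. -/
def GoodStack (s : ℕ → Bool) : Prop := ∀ b, ∃ᶠ i in atTop, s i = b

@[simp] lemma visits_zero (w : ℕ → ℤ) (z : ℤ) : visits w 0 z = 0 := Nat.count_zero _

lemma visits_succ (w : ℕ → ℤ) (n : ℕ) (z : ℤ) :
    visits w (n + 1) z = visits w n z + if w n = z then 1 else 0 := Nat.count_succ _ _

lemma visits_le (w : ℕ → ℤ) (n : ℕ) (z : ℤ) : visits w n z ≤ n := Nat.count_le _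

lemma visits_congr {w w' : ℕ → ℤ} {n : ℕ} (h : ∀ i < n, w i = w' i) (z : ℤ) :
    visits w n z = visits w' n z := by
  induction n with
  | zero => simp
  | succ n ih =>
    rw [visits_succ, visits_succ, ih fun i hi => h i (by omega), h n (by omega)]

lemma visits_eq_of_forall_ge_ne {w : ℕ → ℤ} {z : ℤ} {N n : ℕ} (h : ∀ i ≥ N, w i ≠ z)
    (hn : N ≤ n) : visits w n z = visits w N z := by
  induction n, hn using Nat.le_induction with
  | base => rfl
  | succ n hn ih => rw [visits_succ, ih, if_neg (h n hn), add_zero]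

lemma exists_visits_eq {w : ℕ → ℤ} {z : ℤ} (h : ∃ᶠ n in atTop, w n = z) (i : ℕ) :
    ∃ n, w n = z ∧ visits w n z = i :=
  have hinf := Nat.frequently_atTop_iff_infinite.1 h
  ⟨_, Nat.nth_mem_of_infinite hinf i, Nat.count_nth_of_infinite hinf i⟩

@[simp] lemma rights_zero (s : ℕ → Bool) : rights s 0 = 0 := Nat.count_zero _

@[simp] lemma lefts_zero (s : ℕ → Bool) : lefts s 0 = 0 := Nat.count_zero _

lemma rights_succ (s : ℕ → Bool) (t : ℕ) :
    rights s (t + 1) = rights s t + if s t = true then 1 else 0 := Nat.count_succ _ _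

lemma lefts_succ (s : ℕ → Bool) (t : ℕ) :
    lefts s (t + 1) = lefts s t + if s t = false then 1 else 0 := Nat.count_succ _ _

lemma rights_le (s : ℕ → Bool) (t : ℕ) : rights s t ≤ t := Nat.count_le _

lemma rights_add_lefts (s : ℕ → Bool) (t : ℕ) : rights s t + lefts s t = t := by
  induction t with
  | zero => simp
  | succ t ih => rw [rights_succ, lefts_succ]; cases s t <;> simp <;> omega

lemma GoodStack.exists_lefts_eq {s : ℕ → Bool} (h : GoodStack s) (n : ℕ) : ∃ t, lefts s t = n :=
  ⟨_, Nat.count_nth_of_infinite (Nat.frequently_atTop_iff_infinite.1 (h false)) n⟩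

lemma GoodStack.exists_rights_eq {s : ℕ → Bool} (h : GoodStack s) (n : ℕ) :
    ∃ t, rights s t = n :=
  ⟨_, Nat.count_nth_of_infinite (Nat.frequently_atTop_iff_infinite.1 (h true)) n⟩

section NearestNeighbour

variable {w : ℕ → ℤ}

lemma forall_ge_pos_of_forall_ge_ne_zero {N : ℕ} (hstep : ∀ n, |w (n + 1) - w n| ≤ 1)
    (hN : ∀ n ≥ N, w n ≠ 0) (hpos : 0 < w N) : ∀ n ≥ N, 0 < w n := fun n hn => by
  induction n, hn using Nat.le_induction with
  | base => exact hpos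
  | succ n hn ih =>
    have := abs_le.1 (hstep n)
    have := hN (n + 1) (by omega)
    omega

lemma tendsto_atTop_of_eventually_ne_of_eventually_pos (h : ∀ z, ∀ᶠ n in atTop, w n ≠ z)
    (hpos : ∀ᶠ n in atTop, 0 < w n) : Tendsto w atTop atTop := by
  refine tendsto_atTop.2 fun b => ?_
  filter_upwards [(eventually_all_finset (Finset.Ioo 0 b)).2 fun z _ => h z, hpos] with n hn hn'
  by_contra! hlt
  exact hn (w n) (Finset.mem_Ioo.2 ⟨hn', hlt⟩) rfl

lemma tendsto_atTop_or_atBot_of_eventually_ne (hstep : ∀ n, |w (n + 1) - w n| ≤ 1)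
    (h : ∀ z, ∀ᶠ n in atTop, w n ≠ z) : Tendsto w atTop atTop ∨ Tendsto w atTop atBot := by
  obtain ⟨N, hN⟩ := eventually_atTop.1 (h 0)
  rcases lt_or_gt_of_ne (hN N le_rfl) with hneg | hpos
  · have hstep' (n) : |-w (n + 1) - -w n| ≤ 1 := by
      rw [neg_sub_neg, abs_sub_comm]
      exact hstep n
    have hpos : ∀ n ≥ N, 0 < -w n :=
      forall_ge_pos_of_forall_ge_ne_zero hstep' (fun n hn => neg_ne_zero.2 (hN n hn)) (by omega)
    refine Or.inr (tendsto_neg_atTop_iff.1 ?_)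
    exact tendsto_atTop_of_eventually_ne_of_eventually_pos
      (fun z => (h (-z)).mono fun n hn => by omega) (eventually_atTop.2 ⟨N, hpos⟩)
  · exact Or.inl (tendsto_atTop_of_eventually_ne_of_eventually_pos h
      (eventually_atTop.2 ⟨N, forall_ge_pos_of_forall_ge_ne_zero hstep hN hpos⟩))

end NearestNeighbour

namespace IsStackWalk

variable {η : ℤ → ℕ → Bool} {x : ℤ} {w : ℕ → ℤ}

lemma abs_step_le_one (hw : IsStackWalk η x w) (n : ℕ) : |w (n + 1) - w n| ≤ 1 := by
  rw [hw.step, add_sub_cancel_left]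
  cases η (w n) (visits w n (w n)) <;> simp [arrowSign]

lemma abs_sub_start_le (hw : IsStackWalk η x w) (n : ℕ) : |w n - x| ≤ n := by
  induction n with
  | zero => simp [hw.start]
  | succ n ih =>
    have := abs_le.1 (hw.abs_step_le_one n)
    rw [abs_le] at ih ⊢
    push_cast
    omega

lemma visits_add_natCast_eq_zero (hw : IsStackWalk η x w) {n k : ℕ} (hk : n ≤ k) :
    visits w n (x + k) = 0 := by
  refine Nat.count_of_forall_not fun i hi heq => ?_
  have := abs_le.1 (hw.abs_sub_start_le i)
  omega

/-- Both sides count the steps of the walk from `z` to `z + 1`: a walk crosses an edge in both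
directions equally often, up to one crossing which depends on the sides of its endpoints. -/
lemma rights_visits_add_eq_lefts_visits_add (hw : IsStackWalk η x w) (n : ℕ) (z : ℤ) :
    rights (η z) (visits w n z) + (if z < x then 1 else 0)
      = lefts (η (z + 1)) (visits w n (z + 1)) + if z < w n then 1 else 0 := by
  induction n with
  | zero => simp [hw.start]
  | succ n ih =>
    have hstep := hw.step n
    rw [visits_succ, visits_succ]
    rcases eq_or_ne (w n) z with hz | hz
    · rw [if_pos hz, if_neg (by omega : ¬w n = z + 1), add_zero, rights_succ]
      grind [arrowSign]
    · rcases eq_or_ne (w n) (z + 1) with hz' | hz'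
      · rw [if_neg hz, if_pos hz', add_zero, lefts_succ]
        grind [arrowSign]
      · grind [arrowSign]

lemma last_arrow_eq_false_of_lt (hw : IsStackWalk η x w) {n : ℕ} {z : ℤ} (hz : w n < z)
    (hv : 0 < visits w n z) : η z (visits w n z - 1) = false := by
  induction n with
  | zero => simp at hv
  | succ n ih =>
    have hstep := hw.step n
    grind [visits_succ, arrowSign]

lemma frequently_eq_add_arrowSign (hw : IsStackWalk η x w) {z : ℤ}
    (h : ∃ᶠ n in atTop, w n = z) {b : Bool} (hb : ∃ᶠ i in atTop, η z i = b) :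
    ∃ᶠ n in atTop, w n = z + arrowSign b := by
  rw [frequently_atTop] at hb ⊢
  intro N
  obtain ⟨i, hi, hib⟩ := hb N
  obtain ⟨n, hn, hv⟩ := exists_visits_eq h i
  refine ⟨n + 1, ?_, by rw [hw.step, hn, hv, hib]⟩
  have := visits_le w n z
  omega

lemma frequently_eq_of_frequently_eq (hw : IsStackWalk η x w) (hη : ∀ z, GoodStack (η z))
    {z : ℤ} (h : ∃ᶠ n in atTop, w n = z) (y : ℤ) : ∃ᶠ n in atTop, w n = y := by
  induction y using Int.inductionOn' (b := z) with
  | zero => exact h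
  | succ k _ ih => exact hw.frequently_eq_add_arrowSign ih (hη k true)
  | pred k _ ih => exact hw.frequently_eq_add_arrowSign ih (hη k false)

lemma frequently_eq_or_tendsto (hw : IsStackWalk η x w) (hη : ∀ z, GoodStack (η z)) :
    (∃ᶠ n in atTop, w n = x) ∨ Tendsto w atTop atTop ∨ Tendsto w atTop atBot := by
  refine or_iff_not_imp_left.2 fun hx =>
    tendsto_atTop_or_atBot_of_eventually_ne hw.abs_step_le_one fun z => ?_
  by_contra hz
  exact hx (hw.frequently_eq_of_frequently_eq hη (by simpa [Filter.Frequently] using hz) x)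

end IsStackWalk

/-! ### Exploration of a stack and the branching process -/

/-- One step of the search for a given number of left arrows in a stack: the state `(k, y)` records
that `k` left arrows remain to be found and that `y` right arrows have been passed. The search stops
when `k = 0`. -/
def exploreStep (b : Bool) : ℕ × ℕ → ℕ × ℕ
  | (0, y) => (0, y)
  | (k + 1, y) => if b then (k + 1, y + 1) else (k, y)

/-- The state of the search for `n` left arrows in the stack `s` after `t` arrows. -/
def explore (s : ℕ → Bool) (n : ℕ) : ℕ → ℕ × ℕ
  | 0 => (n, 0)
  | t + 1 => exploreStep (s t) (explore s n t)

/-- The number of right arrows in a stack before its `n`-th left arrow, that is, the number of right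
arrows passed in the search for `n` left arrows. It has the junk value `0` if the search never ends
and passes infinitely many right arrows. -/
noncomputable def rightsBefore (s : ℕ → Bool) (n : ℕ) : ℕ := ⨆ t, (explore s n t).2

/-- The branching process driven by the stacks `σ 0, σ 1, …` and started from `m`: the right arrows
before the `n`-th left arrow of `σ k` are the children of `n` individuals of generation `k`. -/
noncomputable def branching (σ : ℕ → ℕ → Bool) (m : ℕ) : ℕ → ℕ
  | 0 => m
  | k + 1 => rightsBefore (σ k) (branching σ m k)

section Explore

variable {s : ℕ → Bool} {n t : ℕ}

lemma explore_congr {s' : ℕ → Bool} (h : ∀ i < t, s i = s' i) :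
    explore s n t = explore s' n t := by
  induction t with
  | zero => rfl
  | succ t ih => rw [explore, explore, ih fun i hi => h i (by omega), h t (by omega)]

lemma explore_fst (s : ℕ → Bool) (n t : ℕ) : (explore s n t).1 = n - lefts s t := by
  induction t with
  | zero => simp [explore]
  | succ t ih =>
    rw [explore, lefts_succ]
    rcases he : explore s n t with ⟨_ | k, y⟩ <;> rw [he] at ih <;> cases s t <;>
      simp [exploreStep] at ih ⊢ <;> omega

lemma explore_snd_of_lefts_lt (h : lefts s t < n) : (explore s n t).2 = rights s t := by
  induction t with
  | zero => simp [explore]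
  | succ t ih =>
    have hlt : lefts s t < n := by
      rw [lefts_succ] at h
      omega
    have hfst := explore_fst s n t
    have hsnd := ih hlt
    rw [explore, rights_succ]
    rcases he : explore s n t with ⟨_ | k, y⟩ <;> rw [he] at hfst hsnd
    · dsimp only at hfst
      omega
    · cases s t <;> simpa [exploreStep] using hsnd

lemma monotone_explore_snd (s : ℕ → Bool) (n : ℕ) : Monotone fun t => (explore s n t).2 := by
  refine monotone_nat_of_le_succ fun t => ?_
  rw [explore]
  rcases explore s n t with ⟨_ | k, y⟩ <;> cases s t <;> simp [exploreStep]

lemma explore_eq_of_le {y u : ℕ} (h : explore s n t = (0, y)) (hu : t ≤ u) :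
    explore s n u = (0, y) := by
  induction u, hu using Nat.le_induction with
  | base => exact h
  | succ u _ ih => rw [explore, ih, exploreStep]

lemma explore_snd_le {y : ℕ} (h : explore s n t = (0, y)) (u : ℕ) : (explore s n u).2 ≤ y := by
  have hmono := monotone_explore_snd s n (le_max_left u t)
  simpa only [explore_eq_of_le h (le_max_right u t)] using hmono

lemma rightsBefore_eq_of_explore {y : ℕ} (h : explore s n t = (0, y)) : rightsBefore s n = y := by
  refine le_antisymm (ciSup_le (explore_snd_le h)) ?_
  have hle := le_ciSup (f := fun u => (explore s n u).2)
    ⟨y, Set.forall_mem_range.2 (explore_snd_le h)⟩ t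
  simpa only [rightsBefore, h] using hle

lemma rightsBefore_zero (s : ℕ → Bool) : rightsBefore s 0 = 0 :=
  rightsBefore_eq_of_explore (t := 0) rfl

lemma rightsBefore_lefts (ht : 0 < t → s (t - 1) = false) :
    rightsBefore s (lefts s t) = rights s t := by
  rcases t with _ | t
  · rw [lefts_zero, rights_zero, rightsBefore_zero]
  have hs : s t = false := ht t.succ_pos
  have hlefts : lefts s (t + 1) = lefts s t + 1 := by rw [lefts_succ, if_pos hs]
  have hexp : explore s (lefts s t + 1) t = (1, rights s t) :=
    Prod.ext (by rw [explore_fst]; omega) (explore_snd_of_lefts_lt (Nat.lt_succ_self _))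
  refine rightsBefore_eq_of_explore (t := t + 1) ?_
  rw [hlefts, explore, hexp, hs, rights_succ, hs]
  rfl

lemma GoodStack.exists_explore_eq (h : GoodStack s) (n : ℕ) :
    ∃ t, explore s n t = (0, rightsBefore s n) := by
  obtain ⟨t, ht⟩ := h.exists_lefts_eq n
  have hexp : explore s n t = (0, (explore s n t).2) :=
    Prod.ext (by rw [explore_fst, ht, Nat.sub_self]) rfl
  exact ⟨t, by rw [rightsBefore_eq_of_explore hexp, ← hexp]⟩

lemma GoodStack.eventually_explore_eq (h : GoodStack s) (n : ℕ) :
    ∀ᶠ t in atTop, explore s n t = (0, rightsBefore s n) := by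
  obtain ⟨t, ht⟩ := h.exists_explore_eq n
  exact eventually_atTop.2 ⟨t, fun u hu => explore_eq_of_le ht hu⟩

lemma GoodStack.rights_le_rightsBefore (h : GoodStack s) (ht : lefts s t < n) :
    rights s t ≤ rightsBefore s n := by
  obtain ⟨u, hu⟩ := h.exists_explore_eq n
  exact explore_snd_of_lefts_lt ht ▸ explore_snd_le hu t

lemma branching_eq_zero_of_le {σ : ℕ → ℕ → Bool} {m k l : ℕ} (hkl : k ≤ l)
    (h : branching σ m k = 0) : branching σ m l = 0 := by
  induction l, hkl using Nat.le_induction with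
  | base => exact h
  | succ l _ ih => rw [branching, ih, rightsBefore_zero]

lemma branching_congr {σ σ' : ℕ → ℕ → Bool} {m k : ℕ} (h : ∀ i < k, σ i = σ' i) :
    branching σ m k = branching σ' m k := by
  induction k with
  | zero => rfl
  | succ k ih => rw [branching, branching, ih fun i hi => h i (by omega), h k (by omega)]

end Explore

namespace IsStackWalk

variable {η : ℤ → ℕ → Bool} {x : ℤ} {w : ℕ → ℤ}

lemma rights_le_branching (hw : IsStackWalk η x w) (hη : ∀ z, GoodStack (η z)) {n m K : ℕ}
    (hm : visits w n x ≤ m) (hn : x + K < w n) {k : ℕ} (hk : k ≤ K) :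
    rights (η (x + k)) (visits w n (x + k))
      ≤ branching (fun i => η (x + (i + 1 : ℕ))) m k := by
  induction k with
  | zero => simpa [branching] using (rights_le _ _).trans hm
  | succ k ih =>
    have hcross := hw.rights_visits_add_eq_lefts_visits_add n (x + k)
    rw [if_neg (by omega), if_pos (by omega), add_assoc x, ← Nat.cast_succ] at hcross
    rw [branching]
    exact (hη _).rights_le_rightsBefore ((Nat.lt_of_succ_le hcross.ge).trans_le (ih (by omega)))

lemma exists_branching_pos_of_tendsto_atTop (hw : IsStackWalk η x w)
    (hη : ∀ z, GoodStack (η z)) (h : Tendsto w atTop atTop) :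
    ∃ m, ∀ k, 0 < branching (fun i => η (x + (i + 1 : ℕ))) m k := by
  obtain ⟨N, hN⟩ := eventually_atTop.1 (h.eventually_gt_atTop x)
  refine ⟨N, fun k => ?_⟩
  obtain ⟨n, hn, hNn⟩ := ((h.eventually_gt_atTop (x + k)).and (eventually_ge_atTop N)).exists
  have hvisits : visits w n x ≤ N :=
    (visits_eq_of_forall_ge_ne (fun i hi => (hN i hi).ne') hNn).trans_le (visits_le _ _ _)
  have hcross := hw.rights_visits_add_eq_lefts_visits_add n (x + k)
  rw [if_neg (by omega), if_pos hn] at hcross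
  have hle := hw.rights_le_branching hη hvisits hn le_rfl
  omega

lemma rights_eq_branching (hw : IsStackWalk η x w) {n : ℕ} (hn : w n = x) (k : ℕ) :
    rights (η (x + k)) (visits w n (x + k))
      = branching (fun i => η (x + (i + 1 : ℕ))) (rights (η x) (visits w n x)) k := by
  induction k with
  | zero => simp [branching]
  | succ k ih =>
    have hcross := hw.rights_visits_add_eq_lefts_visits_add n (x + k)
    rw [if_neg (by omega), if_neg (by omega), add_assoc x, ← Nat.cast_succ] at hcross
    rw [branching, ← ih, show rights (η (x + k)) _ = _ from hcross]
    exact (rightsBefore_lefts fun hv => hw.last_arrow_eq_false_of_lt (by omega) hv).symm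

lemma exists_branching_eq_zero_of_frequently_eq (hw : IsStackWalk η x w)
    (hη : GoodStack (η x)) (h : ∃ᶠ n in atTop, w n = x) (m : ℕ) :
    ∃ k, branching (fun i => η (x + (i + 1 : ℕ))) m k = 0 := by
  obtain ⟨t, rfl⟩ := hη.exists_rights_eq m
  obtain ⟨n, hn, rfl⟩ := exists_visits_eq h t
  exact ⟨n, by rw [← hw.rights_eq_branching hn, hw.visits_add_natCast_eq_zero le_rfl, rights_zero]⟩

end IsStackWalk

section Measurability

lemma measurable_rights (t : ℕ) : Measurable fun s : ℕ → Bool => rights s t := by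
  induction t with
  | zero => simp only [rights_zero, measurable_const]
  | succ t ih =>
    simp only [rights_succ]
    exact ih.add ((measurable_of_countable fun b : Bool => if b = true then 1 else 0).comp
      (measurable_pi_apply t))

lemma measurable_explore (n t : ℕ) : Measurable fun s : ℕ → Bool => explore s n t := by
  induction t with
  | zero => exact measurable_const
  | succ t ih =>
    exact (measurable_of_countable fun q : Bool × ℕ × ℕ => exploreStep q.1 q.2).comp
      ((measurable_pi_apply t).prodMk ih)

lemma measurable_rightsBefore (n : ℕ) : Measurable fun s : ℕ → Bool => rightsBefore s n :=
  Measurable.iSup fun t => measurable_snd.comp (measurable_explore n t)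

lemma measurable_rightsBefore_uncurry :
    Measurable fun q : (ℕ → Bool) × ℕ => rightsBefore q.1 q.2 :=
  measurable_from_prod_countable_left measurable_rightsBefore

lemma measurable_branching (m k : ℕ) : Measurable fun σ : ℕ → ℕ → Bool => branching σ m k := by
  induction k with
  | zero => exact measurable_const
  | succ k ih => exact measurable_rightsBefore_uncurry.comp ((measurable_pi_apply k).prodMk ih)

lemma measurableSet_goodStack : MeasurableSet {s : ℕ → Bool | GoodStack s} := by
  simp only [GoodStack, frequently_atTop, Set.ofPred_forall, Set.ofPred_exists]
  exact .iInter fun b => .iInter fun i => .iUnion fun j => (MeasurableSet.const _).inter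
    (measurableSet_eq_fun (measurable_pi_apply j) measurable_const)

end Measurability

section Independence

variable {Ω : Type*} [MeasurableSpace Ω] {μ : Measure Ω}

lemma indepFun_of_dependsOn {ι S T : Type*} [MeasurableSpace S] [MeasurableSpace T]
    {ξ : ι → Ω → S} (hind : iIndepFun ξ μ) (hm : ∀ i, Measurable (ξ i))
    {F : (ι → S) → T} (hF : Measurable F) {J : Finset ι} (hJ : DependsOn F J) {i : ι}
    (hi : i ∉ J) : IndepFun (fun ω => F fun j => ξ j ω) (ξ i) μ := by
  classical
  have := hind.isProbabilityMeasure
  obtain ⟨ω₀⟩ := nonempty_of_isProbabilityMeasure μ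
  have heval : Measurable fun v : ({i} : Finset ι) → S => v ⟨i, Finset.mem_singleton_self i⟩ :=
    measurable_pi_apply _
  refine ((hind.indepFun_finset J {i} (by simpa using hi) hm).comp
    (hF.comp (measurable_updateFinset (x := fun j => ξ j ω₀))) heval).congr
    (ae_of_all _ fun ω => hJ fun j hj => ?_) (ae_of_all _ fun ω => rfl)
  simp [Function.updateFinset, Finset.mem_coe.1 hj]

lemma lintegral_eq_sum_of_indepFun {S T : Type*} [MeasurableSpace S] [MeasurableSpace T]
    [Fintype T] [MeasurableSingletonClass T] [IsFiniteMeasure μ] {V : Ω → S} {b : Ω → T}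
    (hind : IndepFun V b μ) (hV : Measurable V) (hb : Measurable b) {g : S → T → ℝ≥0∞}
    (hg : Measurable (Function.uncurry g)) :
    ∫⁻ ω, g (V ω) (b ω) ∂μ = ∑ c, μ (b ⁻¹' {c}) * ∫⁻ ω, g (V ω) c ∂μ := by
  calc ∫⁻ ω, g (V ω) (b ω) ∂μ
      = ∫⁻ q, g q.1 q.2 ∂(μ.map fun ω => (V ω, b ω)) := (lintegral_map hg (hV.prodMk hb)).symm
    _ = ∫⁻ c, ∫⁻ v, g v c ∂μ.map V ∂μ.map b := by
      rw [(indepFun_iff_map_prod_eq_prod_map_map hV.aemeasurable hb.aemeasurable).1 hind,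
        lintegral_prod_symm' (fun q : S × T => g q.1 q.2) hg]
    _ = _ := by
      rw [lintegral_fintype]
      refine Finset.sum_congr rfl fun c _ => ?_
      rw [Measure.map_apply hb (measurableSet_singleton c),
        lintegral_map (f := fun v => g v c) (hg.comp measurable_prodMk_right) hV, mul_comm]

variable {s : ℕ → Ω → Bool} {M : ℕ}

lemma ae_frequently_eq (hind : iIndepFun s μ) (hm : ∀ i, Measurable (s i)) {b : Bool}
    (hfair : ∀ i, M ≤ i → μ (s i ⁻¹' {b}) = 2⁻¹) : ∀ᵐ ω ∂μ, ∃ᶠ i in atTop, s i ω = b := by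
  have := hind.isProbabilityMeasure
  have hmeas : ∀ i, MeasurableSet (s i ⁻¹' {b}) := fun i => hm i (measurableSet_singleton b)
  have hindep : iIndepSet (fun i => s i ⁻¹' {b}) μ :=
    (iIndepSet_iff_meas_biInter hmeas).2 fun S =>
      hind.meas_biInter fun i _ => ⟨{b}, measurableSet_singleton b, rfl⟩
  have hsum : ∑' i, μ (s i ⁻¹' {b}) = ∞ := by
    refine top_le_iff.1 ?_
    calc (⊤ : ℝ≥0∞) = ∑' _ : ℕ, (2⁻¹ : ℝ≥0∞) :=
          (ENNReal.tsum_const_eq_top_of_ne_zero (by simp)).symm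
      _ = ∑' i : ℕ, μ (s (i + M) ⁻¹' {b}) := tsum_congr fun i => (hfair (i + M) (by omega)).symm
      _ ≤ ∑' i, μ (s i ⁻¹' {b}) :=
        ENNReal.tsum_comp_le_tsum_of_injective (add_left_injective M) fun i => μ (s i ⁻¹' {b})
  filter_upwards [(mem_ae_iff_prob_eq_one (MeasurableSet.measurableSet_limsup hmeas)).2
    (measure_limsup_eq_one hmeas hindep hsum)] with ω hω
  rwa [mem_limsup_iff_frequently_mem] at hω

lemma ae_goodStack (hind : iIndepFun s μ) (hm : ∀ i, Measurable (s i))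
    (hfair : ∀ b, ∀ i, M ≤ i → μ (s i ⁻¹' {b}) = 2⁻¹) : ∀ᵐ ω ∂μ, GoodStack fun i => s i ω :=
  ae_all_iff.2 fun b => ae_frequently_eq hind hm (hfair b)

lemma lintegral_explore_succ (hind : iIndepFun s μ) (hm : ∀ i, Measurable (s i)) {t : ℕ}
    (hfair : ∀ b, μ (s t ⁻¹' {b}) = 2⁻¹) {B : ℕ × ℕ → ℝ≥0∞}
    (hB : ∀ k y, 2⁻¹ * B (k + 1, y + 1) + 2⁻¹ * B (k, y) = B (k + 1, y)) (n : ℕ) :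
    ∫⁻ ω, B (explore (fun i => s i ω) n (t + 1)) ∂μ
      = ∫⁻ ω, B (explore (fun i => s i ω) n t) ∂μ := by
  have := hind.isProbabilityMeasure
  let V : Ω → ℕ × ℕ := fun ω => explore (fun i => s i ω) n t
  have hV : Measurable V := (measurable_explore n t).comp (measurable_pi_iff.2 hm)
  have hVt : IndepFun V (s t) μ := indepFun_of_dependsOn hind hm (measurable_explore n t)
    (J := Finset.range t) (fun _ _ h => explore_congr fun i hi => h i (by simpa using hi)) (by simp)
  have hmeas : ∀ b, Measurable fun ω => 2⁻¹ * B (exploreStep b (V ω)) := fun b =>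
    (measurable_of_countable fun v : ℕ × ℕ => 2⁻¹ * B (exploreStep b v)).comp hV
  calc ∫⁻ ω, B (explore (fun i => s i ω) n (t + 1)) ∂μ
      = ∫⁻ ω, B (exploreStep (s t ω) (V ω)) ∂μ := rfl
    _ = ∫⁻ ω, (2⁻¹ * B (exploreStep true (V ω)) + 2⁻¹ * B (exploreStep false (V ω))) ∂μ := by
      rw [lintegral_eq_sum_of_indepFun (g := fun v b => B (exploreStep b v)) hVt hV (hm t)
        (measurable_of_countable _), Fintype.sum_bool, hfair, hfair, lintegral_add_left (hmeas _),
        lintegral_const_mul' _ _ (by simp), lintegral_const_mul' _ _ (by simp)]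
    _ = ∫⁻ ω, B (V ω) ∂μ := by
      refine lintegral_congr fun ω => ?_
      rcases V ω with ⟨_ | k, y⟩
      · simp only [exploreStep, ← add_mul, ENNReal.inv_two_add_inv_two, one_mul]
      · simpa only [exploreStep, if_true, Bool.false_eq_true, if_false] using hB k y

lemma lintegral_rightsBefore (hind : iIndepFun s μ) (hm : ∀ i, Measurable (s i))
    (hfair : ∀ b, ∀ i, M ≤ i → μ (s i ⁻¹' {b}) = 2⁻¹) {B : ℕ × ℕ → ℝ≥0∞}
    (hB : ∀ k y, 2⁻¹ * B (k + 1, y + 1) + 2⁻¹ * B (k, y) = B (k + 1, y)) {C : ℝ≥0∞} (hC : C ≠ ∞)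
    (hBC : ∀ v, B v ≤ C) (n : ℕ) :
    ∫⁻ ω, B (0, rightsBefore (fun i => s i ω) n) ∂μ
      = ∫⁻ ω, B (explore (fun i => s i ω) n M) ∂μ := by
  have := hind.isProbabilityMeasure
  have hconst : ∀ t ≥ M, ∫⁻ ω, B (explore (fun i => s i ω) n t) ∂μ
      = ∫⁻ ω, B (explore (fun i => s i ω) n M) ∂μ := fun t ht => by
    induction t, ht using Nat.le_induction with
    | base => rfl
    | succ t ht ih => rw [lintegral_explore_succ hind hm (fun b => hfair b t ht) hB, ih]
  have hlim : Tendsto (fun t => ∫⁻ ω, B (explore (fun i => s i ω) n t) ∂μ) atTop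
      (nhds (∫⁻ ω, B (0, rightsBefore (fun i => s i ω) n) ∂μ)) := by
    refine tendsto_lintegral_of_dominated_convergence (fun _ => C)
      (fun t => (measurable_of_countable B).comp
        ((measurable_explore n t).comp (measurable_pi_iff.2 hm)))
      (fun t => ae_of_all _ fun ω => hBC _) (by simpa using hC) ?_
    filter_upwards [ae_goodStack hind hm hfair] with ω hω
    refine tendsto_const_nhds.congr' ?_
    filter_upwards [hω.eventually_explore_eq n] with t ht
    rw [ht]
  refine tendsto_nhds_unique hlim (tendsto_const_nhds.congr' ?_)
  exact eventually_atTop.2 ⟨M, fun t ht => (hconst t ht).symm⟩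

end Independence

section MaximumPrinciple

variable {α : Type*} [MeasurableSpace α] {ν : Measure α} [IsProbabilityMeasure ν]

lemma apply_zero_eq_of_forall_le {u : ℕ → ℝ} {φ : α → ℕ} {n : ℕ} (hmax : ∀ k, u k ≤ u n)
    (hint : Integrable (fun s => u (φ s)) ν) (hsub : u n ≤ ∫ s, u (φ s) ∂ν)
    (hpos : 0 < ν {s | φ s = 0}) : u 0 = u n := by
  have hzero : ∫ s, (u n - u (φ s)) ∂ν = 0 := by
    refine le_antisymm ?_ (integral_nonneg fun s => sub_nonneg.2 (hmax _))
    rw [integral_sub (integrable_const _) hint]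
    simpa using hsub
  rw [integral_eq_zero_iff_of_nonneg (fun s => sub_nonneg.2 (hmax _))
    ((integrable_const _).sub hint)] at hzero
  obtain ⟨s, hs, hs'⟩ := ((frequently_ae_iff.2 hpos.ne').and_eventually hzero).exists
  rw [← hs]
  exact (sub_eq_zero.1 hs').symm

variable {φ : ℕ → α → ℕ} {h L : ℕ → ℝ} {N : ℕ}

lemma exists_le_forall_sub_mul_le (hpos : ∀ n, 0 < ν {s | φ n s = 0})
    (hint : ∀ n, Integrable (fun s => h (φ n s)) ν) (h_le : ∀ n, h n ≤ 1)
    (hsub : ∀ n, h n ≤ ∫ s, h (φ n s) ∂ν) (hLtop : Tendsto L atTop atTop)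
    (hLint : ∀ n ≥ N, Integrable (fun s => L (φ n s)) ν)
    (hLsup : ∀ n ≥ N, ∫ s, L (φ n s) ∂ν ≤ L n) {ε : ℝ} (hε : 0 < ε) :
    ∃ a ≤ N, ∀ n, h n - ε * L n ≤ h a - ε * L a := by
  have hbot : Tendsto (fun n => h n - ε * L n) cofinite atBot := by
    rw [Nat.cofinite_eq_atTop]
    exact tendsto_atBot_mono (fun n => sub_le_sub_right (h_le n) _)
      (tendsto_atBot_add_const_left _ 1
        (tendsto_neg_atTop_atBot.comp (hLtop.const_mul_atTop hε)))
  obtain ⟨a, ha⟩ := hbot.exists_forall_ge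
  rcases le_or_gt a N with haN | haN
  · exact ⟨a, haN, ha⟩
  have hLa := (hLint a haN.le).const_mul ε
  have hsub' : h a - ε * L a ≤ ∫ s, (h (φ a s) - ε * L (φ a s)) ∂ν := by
    rw [integral_sub (hint a) hLa, integral_const_mul]
    exact sub_le_sub (hsub a) (mul_le_mul_of_nonneg_left (hLsup a haN.le) hε.le)
  have hzero := apply_zero_eq_of_forall_le (u := fun n => h n - ε * L n) ha
    ((hint a).sub hLa) hsub' (hpos a)
  exact ⟨0, N.zero_le, fun n => (ha n).trans_eq hzero.symm⟩

lemma exists_forall_le_of_lyapunov (hpos : ∀ n, 0 < ν {s | φ n s = 0})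
    (hint : ∀ n, Integrable (fun s => h (φ n s)) ν) (h_le : ∀ n, h n ≤ 1)
    (hsub : ∀ n, h n ≤ ∫ s, h (φ n s) ∂ν) (hL : ∀ n, 0 ≤ L n) (hLtop : Tendsto L atTop atTop)
    (hLint : ∀ n ≥ N, Integrable (fun s => L (φ n s)) ν)
    (hLsup : ∀ n ≥ N, ∫ s, L (φ n s) ∂ν ≤ L n) : ∃ j, ∀ n, h n ≤ h j := by
  obtain ⟨j, -, hj⟩ := (Finset.range (N + 1)).exists_max_image h ⟨0, by simp⟩
  have hle : ∀ n, ∀ ε > 0, h n ≤ ε * L n + h j := fun n ε hε => by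
    obtain ⟨a, haN, ha⟩ := exists_le_forall_sub_mul_le hpos hint h_le hsub hLtop hLint hLsup hε
    have hmul := mul_nonneg hε.le (hL a)
    linarith [ha n, hj a (Finset.mem_range_succ_iff.2 haN)]
  refine ⟨j, fun n => ?_⟩
  have hlim : Tendsto (fun ε : ℝ => ε * L n + h j) (nhdsWithin 0 (Set.Ioi 0))
      (nhds (0 * L n + h j)) := tendsto_nhdsWithin_of_tendsto_nhds
    (((continuous_id.mul continuous_const).add continuous_const).tendsto 0)
  simpa only [zero_mul, zero_add] using
    ge_of_tendsto hlim (eventually_nhdsWithin_of_forall fun ε hε => hle n ε hε)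

lemma nonpos_of_lyapunov (hpos : ∀ n, 0 < ν {s | φ n s = 0})
    (hint : ∀ n, Integrable (fun s => h (φ n s)) ν) (h_le : ∀ n, h n ≤ 1) (h_zero : h 0 = 0)
    (hsub : ∀ n, h n ≤ ∫ s, h (φ n s) ∂ν) (hL : ∀ n, 0 ≤ L n) (hLtop : Tendsto L atTop atTop)
    (hLint : ∀ n ≥ N, Integrable (fun s => L (φ n s)) ν)
    (hLsup : ∀ n ≥ N, ∫ s, L (φ n s) ∂ν ≤ L n) (n : ℕ) : h n ≤ 0 := by
  obtain ⟨j, hj⟩ := exists_forall_le_of_lyapunov hpos hint h_le hsub hL hLtop hLint hLsup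
  exact (hj n).trans_eq (h_zero ▸ apply_zero_eq_of_forall_le hj (hint j) (hsub j) (hpos j)).symm

end MaximumPrinciple

/-- The transition operator of the branching process whose stacks have law `ν`: it maps `g` to the
expectation of `g` at the next generation, as a function of the size of the present one. -/
noncomputable def branchingOp (ν : Measure (ℕ → Bool)) (g : ℕ → ℝ≥0∞) (n : ℕ) : ℝ≥0∞ :=
  ∫⁻ s, g (rightsBefore s n) ∂ν

/-- The probability that the branching process whose stacks have law `ν` never dies out, as a
function of its starting point: the decreasing limit of the probabilities of being alive at
generation `k`. -/
noncomputable def survivalProb (ν : Measure (ℕ → Bool)) (n : ℕ) : ℝ≥0∞ :=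
  ⨅ k, (branchingOp ν)^[k] (Set.indicator {0}ᶜ 1) n

section BranchingOp

variable {ν : Measure (ℕ → Bool)}

lemma branchingOp_mono (ν : Measure (ℕ → Bool)) : Monotone (branchingOp ν) :=
  fun _ _ h _ => lintegral_mono fun _ => h _

lemma lintegral_branching {Ω : Type*} [MeasurableSpace Ω] {μ : Measure Ω} {σ : ℕ → Ω → ℕ → Bool}
    (hind : iIndepFun σ μ) (hm : ∀ k, Measurable (σ k)) (hν : ∀ k, μ.map (σ k) = ν) (m k : ℕ)
    (g : ℕ → ℝ≥0∞) :
    ∫⁻ ω, g (branching (fun k => σ k ω) m k) ∂μ = (branchingOp ν)^[k] g m := by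
  have := hind.isProbabilityMeasure
  induction k generalizing g with
  | zero => simp [branching]
  | succ k ih =>
    let V : Ω → ℕ := fun ω => branching (fun k => σ k ω) m k
    have hV : Measurable V := (measurable_branching m k).comp (measurable_pi_iff.2 hm)
    have hVk : IndepFun V (σ k) μ := indepFun_of_dependsOn hind hm (measurable_branching m k)
      (J := Finset.range k) (fun _ _ h => branching_congr fun i hi => h i (by simpa using hi))
      (by simp)
    have hG : Measurable fun q : ℕ × (ℕ → Bool) => g (rightsBefore q.2 q.1) :=
      (measurable_of_countable g).comp (measurable_rightsBefore_uncurry.comp measurable_swap)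
    have hlaw := (indepFun_iff_map_prod_eq_prod_map_map hV.aemeasurable (hm k).aemeasurable).1 hVk
    rw [hν] at hlaw
    have : IsProbabilityMeasure ν := hν k ▸ Measure.isProbabilityMeasure_map (hm k).aemeasurable
    calc ∫⁻ ω, g (branching (fun k => σ k ω) m (k + 1)) ∂μ
        = ∫⁻ q, g (rightsBefore q.2 q.1) ∂(μ.map fun ω => (V ω, σ k ω)) :=
          (lintegral_map hG (hV.prodMk (hm k))).symm
      _ = ∫⁻ v, branchingOp ν g v ∂μ.map V := by
          rw [hlaw, lintegral_prod _ hG.aemeasurable]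
          rfl
      _ = ∫⁻ ω, branchingOp ν g (V ω) ∂μ := lintegral_map (measurable_of_countable _) hV
      _ = _ := ih _

lemma survivalProb_zero (ν : Measure (ℕ → Bool)) : survivalProb ν 0 = 0 :=
  le_antisymm ((iInf_le _ 0).trans_eq (by simp)) zero_le

lemma survivalProb_le_one (ν : Measure (ℕ → Bool)) (n : ℕ) : survivalProb ν n ≤ 1 :=
  (iInf_le _ 0).trans (Set.indicator_apply_le fun _ => le_rfl)

variable [IsProbabilityMeasure ν]

lemma antitone_iterate_branchingOp (ν : Measure (ℕ → Bool)) [IsProbabilityMeasure ν] :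
    Antitone fun k => (branchingOp ν)^[k] (Set.indicator {0}ᶜ 1) := by
  refine (branchingOp_mono ν).antitone_iterate_of_map_le fun n => ?_
  rcases eq_or_ne n 0 with rfl | hn
  · simp [branchingOp, rightsBefore_zero]
  · calc branchingOp ν (Set.indicator {0}ᶜ 1) n ≤ ∫⁻ _, 1 ∂ν :=
          lintegral_mono fun s => Set.indicator_apply_le fun _ => le_rfl
      _ = Set.indicator {0}ᶜ 1 n := by simp [hn]

lemma survivalProb_le_branchingOp (n : ℕ) :
    survivalProb ν n ≤ branchingOp ν (survivalProb ν) n := by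
  have hanti := antitone_iterate_branchingOp ν
  simp only [branchingOp, survivalProb]
  rw [lintegral_iInf (f := fun k s => (branchingOp ν)^[k] (Set.indicator {0}ᶜ 1) (rightsBefore s n))
    (fun k => (measurable_of_countable _).comp (measurable_rightsBefore n))
    (fun _ _ h s => hanti h _)]
  · refine le_iInf fun k => (iInf_le _ (k + 1)).trans_eq ?_
    rw [Function.iterate_succ_apply', branchingOp]
  · have hone : ∀ k : ℕ, Set.indicator {0}ᶜ 1 k ≤ (1 : ℝ≥0∞) := fun k =>
      Set.indicator_apply_le fun _ => le_rfl
    exact ((lintegral_mono fun s => hone (rightsBefore s n)).trans_lt (by simp)).ne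

lemma toReal_survivalProb_le_integral (n : ℕ) :
    (survivalProb ν n).toReal ≤ ∫ s, (survivalProb ν (rightsBefore s n)).toReal ∂ν := by
  rw [integral_toReal (f := fun s => survivalProb ν (rightsBefore s n))
    ((measurable_of_countable (survivalProb ν)).comp (measurable_rightsBefore n)).aemeasurable
    (ae_of_all _ fun s => (survivalProb_le_one ν _).trans_lt ENNReal.one_lt_top)]
  refine ENNReal.toReal_mono (ne_top_of_le_ne_top ENNReal.one_ne_top ?_)
    (survivalProb_le_branchingOp n)
  simpa using lintegral_mono (μ := ν) fun s => survivalProb_le_one ν (rightsBefore s n)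

lemma survivalProb_eq_zero (hpos : ∀ n, 0 < ν {s | rightsBefore s n = 0}) {L : ℕ → ℝ}
    (hL : ∀ n, 0 ≤ L n) (hLtop : Tendsto L atTop atTop) {N : ℕ}
    (hLsup : ∀ n ≥ N, branchingOp ν (fun k => ENNReal.ofReal (L k)) n ≤ ENNReal.ofReal (L n))
    (m : ℕ) : survivalProb ν m = 0 := by
  have hmeas : ∀ (u : ℕ → ℝ) n, AEStronglyMeasurable (fun s => u (rightsBefore s n)) ν := fun u n =>
    ((measurable_of_countable u).comp (measurable_rightsBefore n)).aestronglyMeasurable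
  have h_le : ∀ n, (survivalProb ν n).toReal ≤ 1 := fun n =>
    ENNReal.toReal_le_of_le_ofReal zero_le_one (by simpa using survivalProb_le_one ν n)
  have hint : ∀ n, Integrable (fun s => (survivalProb ν (rightsBefore s n)).toReal) ν := fun n =>
    .of_bound (hmeas (fun k => (survivalProb ν k).toReal) n) 1 (ae_of_all _ fun s => by
      simpa only [Real.norm_of_nonneg ENNReal.toReal_nonneg] using h_le _)
  have hLint : ∀ n ≥ N, Integrable (fun s => L (rightsBefore s n)) ν := fun n hn =>
    ⟨hmeas L n, (hasFiniteIntegral_iff_ofReal (ae_of_all _ fun s => hL _)).2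
      ((hLsup n hn).trans_lt ENNReal.ofReal_lt_top)⟩
  have hLsup' : ∀ n ≥ N, ∫ s, L (rightsBefore s n) ∂ν ≤ L n := fun n hn => by
    rw [integral_eq_lintegral_of_nonneg_ae (ae_of_all _ fun s => hL _) (hmeas L n)]
    exact ENNReal.toReal_le_of_le_ofReal (hL n) (hLsup n hn)
  have hnonpos := nonpos_of_lyapunov (h := fun n => (survivalProb ν n).toReal)
    (φ := fun n s => rightsBefore s n) hpos hint h_le (by simp [survivalProb_zero])
    toReal_survivalProb_le_integral hL hLtop hLint hLsup' m
  exact ((ENNReal.toReal_eq_zero_iff _).1 (hnonpos.antisymm ENNReal.toReal_nonneg)).resolve_right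
    (ne_top_of_le_ne_top ENNReal.one_ne_top (survivalProb_le_one ν m))

end BranchingOp

section Extinction

variable {Ω : Type*} [MeasurableSpace Ω] {μ : Measure Ω} {σ : ℕ → Ω → ℕ → Bool}
  {ν : Measure (ℕ → Bool)}

lemma measure_exists_branching_eq_zero_le (hind : iIndepFun σ μ) (hm : ∀ k, Measurable (σ k))
    (hν : ∀ k, μ.map (σ k) = ν) {g : ℕ → ℝ≥0∞} (hg0 : 1 ≤ g 0) (hg : branchingOp ν g ≤ g)
    (m : ℕ) : μ {ω | ∃ k, branching (fun k => σ k ω) m k = 0} ≤ g m := by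
  have hmono : Monotone fun k => {ω | branching (fun k => σ k ω) m k = 0} :=
    fun k l hkl ω hω => branching_eq_zero_of_le hkl hω
  rw [Set.ofPred_exists, hmono.measure_iUnion]
  refine iSup_le fun k => ?_
  have hV : Measurable fun ω => branching (fun k => σ k ω) m k :=
    (measurable_branching m k).comp (measurable_pi_iff.2 hm)
  calc μ {ω | branching (fun k => σ k ω) m k = 0}
      ≤ μ {ω | 1 ≤ g (branching (fun k => σ k ω) m k)} := measure_mono fun ω hω => by
        simpa only [Set.mem_ofPred_eq, show branching _ m k = 0 from hω] using hg0
    _ ≤ ∫⁻ ω, g (branching (fun k => σ k ω) m k) ∂μ := by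
        simpa using mul_meas_ge_le_lintegral ((measurable_of_countable g).comp hV) (ε := 1)
    _ = (branchingOp ν)^[k] g m := lintegral_branching hind hm hν m k g
    _ ≤ g m := (branchingOp_mono ν).antitone_iterate_of_map_le hg (Nat.zero_le k) m

lemma measure_forall_branching_ne_zero_le (hind : iIndepFun σ μ) (hm : ∀ k, Measurable (σ k))
    (hν : ∀ k, μ.map (σ k) = ν) (m : ℕ) :
    μ {ω | ∀ k, branching (fun k => σ k ω) m k ≠ 0} ≤ survivalProb ν m := by
  refine le_iInf fun k => ?_
  have hset : MeasurableSet {ω | branching (fun k => σ k ω) m k ≠ 0} :=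
    ((measurable_branching m k).comp (measurable_pi_iff.2 hm)) (measurableSet_singleton 0).compl
  calc μ {ω | ∀ k, branching (fun k => σ k ω) m k ≠ 0}
      ≤ μ {ω | branching (fun k => σ k ω) m k ≠ 0} := measure_mono fun ω hω => hω k
    _ = ∫⁻ ω, {ω | branching (fun k => σ k ω) m k ≠ 0}.indicator 1 ω ∂μ :=
        (lintegral_indicator_one hset).symm
    _ = _ := lintegral_branching hind hm hν m k (Set.indicator {0}ᶜ 1)

lemma ae_exists_branching_eq_zero [IsProbabilityMeasure ν] (hind : iIndepFun σ μ)
    (hm : ∀ k, Measurable (σ k)) (hν : ∀ k, μ.map (σ k) = ν)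
    (hpos : ∀ n, 0 < ν {s | rightsBefore s n = 0}) {L : ℕ → ℝ} (hL : ∀ n, 0 ≤ L n)
    (hLtop : Tendsto L atTop atTop) {N : ℕ}
    (hLsup : ∀ n ≥ N, branchingOp ν (fun k => ENNReal.ofReal (L k)) n ≤ ENNReal.ofReal (L n))
    (m : ℕ) : ∀ᵐ ω ∂μ, ∃ k, branching (fun k => σ k ω) m k = 0 := by
  have hle := measure_forall_branching_ne_zero_le hind hm hν m
  rw [survivalProb_eq_zero hpos hL hLtop hLsup, nonpos_iff_eq_zero] at hle
  simpa only [ae_iff, not_exists] using hle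

end Extinction

/-! ### The law of a random stack of arrows -/

/-- The stack of arrows obtained from the cookies `p` and the uniform variables `u`. -/
noncomputable def stackOf (p u : ℕ → unitInterval) (i : ℕ) : Bool := decide (u i < p i)

/-- The law of a sequence of independent uniform variables. -/
noncomputable def uniformSeq : Measure (ℕ → unitInterval) :=
  Measure.infinitePi fun _ : ℕ => (volume : Measure unitInterval)

instance : IsProbabilityMeasure uniformSeq := by unfold uniformSeq; infer_instance

/-- The law of a stack of arrows whose cookies have law `ρ`. -/
noncomputable def stackLaw (ρ : Measure (ℕ → unitInterval)) : Measure (ℕ → Bool) :=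
  (ρ.prod uniformSeq).map fun q => stackOf q.1 q.2

/-- The probability that a cookie of strength `p` produces the arrow `b`. -/
noncomputable def cookieWeight (p : unitInterval) (b : Bool) : ℝ≥0∞ :=
  if b then ENNReal.ofReal p else ENNReal.ofReal (1 - p)

lemma cookieWeight_half {p : unitInterval} (hp : (p : ℝ) = 1 / 2) (b : Bool) :
    cookieWeight p b = 2⁻¹ := by
  have hhalf : (1 : ℝ) - 2⁻¹ = 2⁻¹ := by norm_num
  cases b <;> simp [cookieWeight, hp, hhalf, ENNReal.ofReal_inv_of_pos]

lemma measurable_decide_lt :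
    Measurable fun q : unitInterval × unitInterval => decide (q.1 < q.2) := by
  refine measurable_to_bool ?_
  have hpre : (fun q : unitInterval × unitInterval => decide (q.1 < q.2)) ⁻¹' {true}
      = {q | q.1 < q.2} := by
    ext q
    simp
  exact hpre ▸ measurableSet_lt measurable_fst measurable_snd

lemma measurable_stackOf :
    Measurable fun q : (ℕ → unitInterval) × (ℕ → unitInterval) => stackOf q.1 q.2 :=
  measurable_pi_iff.2 fun i =>
    have h : Measurable fun q : (ℕ → unitInterval) × (ℕ → unitInterval) => (q.2 i, q.1 i) := by
      fun_prop
    measurable_decide_lt.comp h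

lemma measurable_stackOf_apply (p : ℕ → unitInterval) (i : ℕ) :
    Measurable fun u => stackOf p u i :=
  (measurable_pi_apply i).comp (measurable_stackOf.comp measurable_prodMk_left)

instance (ρ : Measure (ℕ → unitInterval)) [IsProbabilityMeasure ρ] :
    IsProbabilityMeasure (stackLaw ρ) :=
  Measure.isProbabilityMeasure_map measurable_stackOf.aemeasurable

lemma iIndepFun_stackOf (p : ℕ → unitInterval) :
    iIndepFun (fun i u => stackOf p u i) uniformSeq :=
  iIndepFun_infinitePi (X := fun i (u : unitInterval) => decide (u < p i))
    fun _ => measurable_decide_lt.comp measurable_prodMk_right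

lemma volume_decide_lt (p : unitInterval) (b : Bool) :
    volume ((fun u : unitInterval => decide (u < p)) ⁻¹' {b}) = cookieWeight p b := by
  cases b
  · have hpre : (fun u : unitInterval => decide (u < p)) ⁻¹' {false} = Set.Ici p := by
      ext u
      simp
    simp [hpre, cookieWeight]
  · have hpre : (fun u : unitInterval => decide (u < p)) ⁻¹' {true} = Set.Iio p := by
      ext u
      simp
    simp [hpre, cookieWeight]

lemma uniformSeq_stackOf_preimage (p : ℕ → unitInterval) (i : ℕ) (b : Bool) :
    uniformSeq ((fun u => stackOf p u i) ⁻¹' {b}) = cookieWeight (p i) b := by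
  have hset : MeasurableSet ((fun u : unitInterval => decide (u < p i)) ⁻¹' {b}) :=
    (measurable_decide_lt.comp measurable_prodMk_right) (measurableSet_singleton b)
  rw [← volume_decide_lt, ← Measure.infinitePi_map_eval
    (fun _ : ℕ => (volume : Measure unitInterval)) i,
    Measure.map_apply (measurable_pi_apply i) hset]
  rfl

lemma lintegral_stackLaw (ρ : Measure (ℕ → unitInterval)) {G : (ℕ → Bool) → ℝ≥0∞}
    (hG : Measurable G) :
    ∫⁻ s, G s ∂stackLaw ρ = ∫⁻ p, ∫⁻ u, G (stackOf p u) ∂uniformSeq ∂ρ := by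
  rw [stackLaw, lintegral_map hG measurable_stackOf]
  exact lintegral_prod _ (hG.comp measurable_stackOf).aemeasurable

lemma ae_stackLaw_of_ae_ae {ρ : Measure (ℕ → unitInterval)} {A : Set (ℕ → Bool)}
    (hA : MeasurableSet A) (h : ∀ᵐ p ∂ρ, ∀ᵐ u ∂uniformSeq, stackOf p u ∈ A) :
    ∀ᵐ s ∂stackLaw ρ, s ∈ A :=
  (ae_map_iff measurable_stackOf.aemeasurable hA).2
    ((Measure.ae_prod_mem_iff_ae_ae_mem (measurable_stackOf hA)).2 h)

lemma rightsBefore_eq_zero_of_forall_lt {s : ℕ → Bool} {n : ℕ} (h : ∀ i < n, s i = false) :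
    rightsBefore s n = 0 := by
  have hr : rights s n = 0 := Nat.count_of_forall_not fun i hi => by simp [h i hi]
  have hl : lefts s n = n := by simpa [hr] using rights_add_lefts s n
  simpa only [hl, hr] using rightsBefore_lefts (s := s) (t := n) fun hn => h _ (by omega)

lemma stackLaw_rightsBefore_eq_zero_pos {ρ : Measure (ℕ → unitInterval)}
    (hρ : 0 < ρ {p | ∀ i, (p i : ℝ) < 1}) (n : ℕ) :
    0 < stackLaw ρ {s | rightsBefore s n = 0} := by
  have hset : MeasurableSet {s : ℕ → Bool | rightsBefore s n = 0} :=
    measurable_rightsBefore n (measurableSet_singleton 0)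
  have hpos : ∀ p : ℕ → unitInterval, (∀ i, (p i : ℝ) < 1) →
      0 < uniformSeq {u | rightsBefore (stackOf p u) n = 0} := fun p hp => calc
    0 < ∏ i ∈ Finset.range n, cookieWeight (p i) false :=
        CanonicallyOrderedAdd.prod_pos.2 fun i _ => by simpa [cookieWeight] using hp i
    _ = uniformSeq (⋂ i ∈ Finset.range n, (fun u => stackOf p u i) ⁻¹' {false}) := by
        simp_rw [← uniformSeq_stackOf_preimage]
        exact ((iIndepFun_stackOf p).meas_biInter fun i _ =>
          ⟨{false}, measurableSet_singleton false, rfl⟩).symm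
    _ ≤ uniformSeq {u | rightsBefore (stackOf p u) n = 0} := measure_mono fun u hu =>
        rightsBefore_eq_zero_of_forall_lt fun i hi =>
          Set.mem_iInter₂.1 hu i (Finset.mem_range.2 hi)
  rw [stackLaw, Measure.map_apply measurable_stackOf hset,
    Measure.prod_apply (measurable_stackOf hset),
    lintegral_pos_iff_support (measurable_measure_prodMk_left (measurable_stackOf hset))]
  exact hρ.trans_le (measure_mono fun p hp => (hpos p hp).ne')

section FairTail

variable {ρ : Measure (ℕ → unitInterval)} {M : ℕ}

lemma ae_goodStack_stackLaw (hρ : ∀ᵐ p ∂ρ, ∀ i, M ≤ i → (p i : ℝ) = 1 / 2) :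
    ∀ᵐ s ∂stackLaw ρ, GoodStack s := by
  refine ae_stackLaw_of_ae_ae (A := {s | GoodStack s}) measurableSet_goodStack ?_
  filter_upwards [hρ] with p hp
  exact ae_goodStack (iIndepFun_stackOf p) (measurable_stackOf_apply p) fun b i hi => by
    rw [uniformSeq_stackOf_preimage, cookieWeight_half (hp i hi)]

lemma lintegral_rightsBefore_stackLaw (hρ : ∀ᵐ p ∂ρ, ∀ i, M ≤ i → (p i : ℝ) = 1 / 2)
    {B : ℕ × ℕ → ℝ≥0∞} (hB : ∀ k y, 2⁻¹ * B (k + 1, y + 1) + 2⁻¹ * B (k, y) = B (k + 1, y))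
    {C : ℝ≥0∞} (hC : C ≠ ∞) (hBC : ∀ v, B v ≤ C) (n : ℕ) :
    ∫⁻ s, B (0, rightsBefore s n) ∂stackLaw ρ = ∫⁻ s, B (explore s n M) ∂stackLaw ρ := by
  rw [lintegral_stackLaw ρ (G := fun s => B (0, rightsBefore s n))
      ((measurable_of_countable fun y => B (0, y)).comp (measurable_rightsBefore n)),
    lintegral_stackLaw ρ (G := fun s => B (explore s n M))
      ((measurable_of_countable B).comp (measurable_explore n M))]
  refine lintegral_congr_ae ?_
  filter_upwards [hρ] with p hp
  refine lintegral_rightsBefore (iIndepFun_stackOf p) (measurable_stackOf_apply p)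
    (fun b i hi => ?_) hB hC hBC n
  rw [uniformSeq_stackOf_preimage, cookieWeight_half (hp i hi)]

lemma sum_arrowSign (s : ℕ → Bool) (t : ℕ) :
    ∑ i ∈ Finset.range t, (arrowSign (s i) : ℝ) = rights s t - lefts s t := by
  induction t with
  | zero => simp
  | succ t ih =>
    rw [Finset.sum_range_succ, ih, rights_succ, lefts_succ]
    cases s t <;> simp [arrowSign] <;> ring

lemma integral_arrowSign_stackOf (p : ℕ → unitInterval) (i : ℕ) :
    ∫ u, (arrowSign (stackOf p u i) : ℝ) ∂uniformSeq = 2 * p i - 1 := by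
  have hm := measurable_stackOf_apply p i
  have hp : (0 : ℝ) ≤ 1 - p i := sub_nonneg.2 (p i).2.2
  rw [← integral_map (φ := fun u => stackOf p u i) hm.aemeasurable (f := fun b => (arrowSign b : ℝ))
    (measurable_of_countable _).aestronglyMeasurable, integral_fintype .of_finite]
  simp only [map_measureReal_apply hm (measurableSet_singleton _), measureReal_def,
    uniformSeq_stackOf_preimage, Fintype.sum_bool, cookieWeight, arrowSign]
  simp [(p i).2.1, hp]
  ring

end FairTail

lemma integral_rights_sub_lefts_stackLaw (ρ : Measure (ℕ → unitInterval)) [IsFiniteMeasure ρ]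
    (M : ℕ) :
    ∫ s, (rights s M - lefts s M : ℝ) ∂stackLaw ρ
      = ∫ p, ∑ i ∈ Finset.range M, (2 * (p i : ℝ) - 1) ∂ρ := by
  have hsign : Measurable fun b : Bool => (arrowSign b : ℝ) := measurable_of_countable _
  have hmeas : ∀ i, Measurable fun s : ℕ → Bool => (arrowSign (s i) : ℝ) := fun i =>
    hsign.comp (measurable_pi_apply i)
  have hbound : ∀ b : Bool, ‖(arrowSign b : ℝ)‖ ≤ 1 := fun b => by cases b <;> simp [arrowSign]
  simp only [← sum_arrowSign]
  rw [stackLaw, integral_map measurable_stackOf.aemeasurable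
    (Finset.measurable_sum _ fun i _ => hmeas i).aestronglyMeasurable, integral_prod]
  · refine integral_congr_ae (ae_of_all _ fun p => ?_)
    have hint : ∀ i, Integrable (fun u => (arrowSign (stackOf p u i) : ℝ)) uniformSeq := fun i =>
      .of_bound (hsign.comp (measurable_stackOf_apply p i)).aestronglyMeasurable 1
        (ae_of_all _ fun u => hbound _)
    exact (integral_finsetSum _ fun i _ => hint i).trans
      (Finset.sum_congr rfl fun i _ => integral_arrowSign_stackOf p i)
  · exact integrable_finsetSum _ fun i _ => .of_bound
      ((hmeas i).comp measurable_stackOf).aestronglyMeasurable 1 (ae_of_all _ fun q => hbound _)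

/-- The point `1 - 1 / u`. The offspring generating function `s ↦ 1 / (2 - s)` of the fair
branching process maps it to `invCompl (u + 1)`. -/
noncomputable def invCompl (u : ℕ) : ℝ := 1 - (u : ℝ)⁻¹

/-- The branching process with stack law `ν` is a perturbation of the fair one whose drift is `δ`:
the generating function of its next generation, which equals `invCompl (u + 1) ^ n` at `invCompl u`
in the fair case, has relative first order perturbation `-δ / u`, uniformly in the size `n` of the
present generation. -/
def HasDrift (ν : Measure (ℕ → Bool)) (δ : ℝ) : Prop :=
  ∃ (C : ℝ) (N : ℕ), ∀ n ≥ N, ∀ u ≥ N,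
    |∫ s, invCompl u ^ rightsBefore s n ∂ν - invCompl (u + 1) ^ n * (1 - δ * (u : ℝ)⁻¹)|
      ≤ invCompl (u + 1) ^ n * (C * (u : ℝ)⁻¹ ^ 2)

lemma invCompl_nonneg {u : ℕ} (hu : 0 < u) : 0 ≤ invCompl u :=
  sub_nonneg.2 (inv_le_one_of_one_le₀ (by exact_mod_cast hu))

lemma invCompl_pos {u : ℕ} (hu : 1 < u) : 0 < invCompl u :=
  sub_pos.2 (inv_lt_one_of_one_lt₀ (by exact_mod_cast hu))

lemma invCompl_lt_one {u : ℕ} (hu : 0 < u) : invCompl u < 1 :=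
  sub_lt_self _ (inv_pos.2 (by exact_mod_cast hu))

lemma inv_one_add_inv_natCast {u : ℕ} (hu : 0 < u) : (1 + (u : ℝ)⁻¹)⁻¹ = invCompl (u + 1) := by
  have : (u : ℝ) ≠ 0 := by positivity
  rw [invCompl]
  push_cast
  field_simp
  ring

lemma abs_pow_mul_pow_sub_le {x : ℝ} (hx0 : 0 ≤ x) (hx1 : x ≤ 1) {r l : ℕ}
    (h : (r + l) * x ≤ 1) :
    |(1 - x) ^ r * (1 + x) ^ l - (1 - (r - l) * x)| ≤ ((r + l) * x) ^ 2 := by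
  have hrx : 0 ≤ r * x := by positivity
  have hlx : 0 ≤ l * x := by positivity
  refine abs_sub_le_iff.2 ⟨?_, ?_⟩
  · have hpow : (1 - x) ^ r * (1 + x) ^ l ≤ Real.exp ((l - r) * x) := calc
      (1 - x) ^ r * (1 + x) ^ l ≤ Real.exp (-x) ^ r * Real.exp x ^ l :=
        mul_le_mul (pow_le_pow_left₀ (by linarith) (Real.one_sub_le_exp_neg x) r)
          (pow_le_pow_left₀ (by linarith) ((add_comm _ _).trans_le (Real.add_one_le_exp x)) l)
          (by positivity) (by positivity)
      _ = Real.exp ((l - r) * x) := by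
        rw [← Real.exp_nat_mul, ← Real.exp_nat_mul, ← Real.exp_add]
        ring_nf
    have hexp := (abs_le.1 (Real.abs_exp_sub_one_sub_id_le (x := (l - r) * x)
      (abs_le.2 ⟨by linarith, by linarith⟩))).2
    nlinarith
  · have hr : 1 - r * x ≤ (1 - x) ^ r := by
      simpa [sub_eq_add_neg] using one_add_mul_le_pow (a := -x) (by linarith) r
    have hl : 1 + l * x ≤ (1 + x) ^ l := one_add_mul_le_pow (by linarith) l
    have hmul := mul_le_mul hr hl (by linarith) (pow_nonneg (by linarith) r)
    nlinarith

lemma integrable_comp_rights {ν : Measure (ℕ → Bool)} [IsFiniteMeasure ν] (g : ℕ → ℝ) (t : ℕ) :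
    Integrable (fun s => g (rights s t)) ν :=
  .of_bound ((measurable_of_countable g).comp (measurable_rights t)).aestronglyMeasurable
    (∑ k ∈ Finset.range (t + 1), ‖g k‖) <| ae_of_all _ fun s =>
      Finset.single_le_sum (f := fun k => ‖g k‖) (fun _ _ => norm_nonneg _)
        (Finset.mem_range.2 (Nat.lt_succ_of_le (rights_le s t)))

section StackLaw

variable {ρ : Measure (ℕ → unitInterval)} {M : ℕ}

lemma integral_rightsBefore_stackLaw (hρ : ∀ᵐ p ∂ρ, ∀ i, M ≤ i → (p i : ℝ) = 1 / 2)
    {F : ℕ × ℕ → ℝ} (hF : ∀ k y, F (k + 1, y + 1) + F (k, y) = 2 * F (k + 1, y))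
    (hF0 : ∀ v, 0 ≤ F v) {C : ℝ} (hFC : ∀ v, F v ≤ C) (n : ℕ) :
    ∫ s, F (0, rightsBefore s n) ∂stackLaw ρ = ∫ s, F (explore s n M) ∂stackLaw ρ := by
  have hharm : ∀ k y, 2⁻¹ * ENNReal.ofReal (F (k + 1, y + 1)) + 2⁻¹ * ENNReal.ofReal (F (k, y))
      = ENNReal.ofReal (F (k + 1, y)) := fun k y => by
    rw [← mul_add, ← ENNReal.ofReal_add (hF0 _) (hF0 _), hF, ENNReal.ofReal_mul (by norm_num),
      ENNReal.ofReal_ofNat, ENNReal.inv_mul_cancel_left two_ne_zero ENNReal.ofNat_ne_top]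
  rw [integral_eq_lintegral_of_nonneg_ae (ae_of_all _ fun s => hF0 _)
      ((measurable_of_countable fun y => F (0, y)).comp
        (measurable_rightsBefore n)).aestronglyMeasurable,
    integral_eq_lintegral_of_nonneg_ae (ae_of_all _ fun s => hF0 _)
      ((measurable_of_countable F).comp (measurable_explore n M)).aestronglyMeasurable,
    lintegral_rightsBefore_stackLaw hρ (B := fun v => ENNReal.ofReal (F v)) hharm
      ENNReal.ofReal_ne_top (fun v => ENNReal.ofReal_le_ofReal (hFC v)) n]

lemma integral_pow_rightsBefore_stackLaw (hρ : ∀ᵐ p ∂ρ, ∀ i, M ≤ i → (p i : ℝ) = 1 / 2) {x : ℝ}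
    (hx0 : 0 ≤ x) (hx1 : x ≤ 1) {n : ℕ} (hn : M < n) :
    ∫ s, (1 - x) ^ rightsBefore s n ∂stackLaw ρ
      = (1 + x)⁻¹ ^ n * ∫ s, (1 - x) ^ rights s M * (1 + x) ^ lefts s M ∂stackLaw ρ := by
  have hq : 0 ≤ 1 - x := sub_nonneg.2 hx1
  let F : ℕ × ℕ → ℝ := fun v => (1 - x) ^ v.2 * (1 + x)⁻¹ ^ v.1
  have hF0 : ∀ v, 0 ≤ F v := fun v => by positivity
  have hF1 : ∀ v, F v ≤ 1 := fun v =>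
    mul_le_one₀ (pow_le_one₀ hq (by linarith)) (by positivity)
      (pow_le_one₀ (by positivity) (inv_le_one_of_one_le₀ (by linarith)))
  have hharm : ∀ k y, F (k + 1, y + 1) + F (k, y) = 2 * F (k + 1, y) := fun k y => by
    simp only [F, pow_succ]
    field_simp
    ring
  calc ∫ s, (1 - x) ^ rightsBefore s n ∂stackLaw ρ
      = ∫ s, F (0, rightsBefore s n) ∂stackLaw ρ := by simp [F]
    _ = ∫ s, F (explore s n M) ∂stackLaw ρ := integral_rightsBefore_stackLaw hρ hharm hF0 hF1 n
    _ = ∫ s, (1 + x)⁻¹ ^ n * ((1 - x) ^ rights s M * (1 + x) ^ lefts s M) ∂stackLaw ρ := by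
        refine integral_congr_ae (ae_of_all _ fun s => ?_)
        have hlt : lefts s M < n := by have := rights_add_lefts s M; omega
        simp only [F, explore_fst, explore_snd_of_lefts_lt hlt]
        rw [inv_pow_sub₀ (by positivity) hlt.le, inv_pow]
        ring
    _ = _ := integral_const_mul _ _

lemma abs_integral_pow_rightsBefore_stackLaw_sub_le [IsProbabilityMeasure ρ]
    (hρ : ∀ᵐ p ∂ρ, ∀ i, M ≤ i → (p i : ℝ) = 1 / 2) {x : ℝ} (hx0 : 0 ≤ x) (hx1 : x ≤ 1)
    (hMx : M * x ≤ 1) {n : ℕ} (hn : M < n) :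
    |∫ s, (1 - x) ^ rightsBefore s n ∂stackLaw ρ
        - (1 + x)⁻¹ ^ n * (1 - (∫ p, ∑ i ∈ Finset.range M, (2 * (p i : ℝ) - 1) ∂ρ) * x)|
      ≤ (1 + x)⁻¹ ^ n * (M * x) ^ 2 := by
  have hsum : ∀ s : ℕ → Bool, (rights s M + lefts s M : ℝ) = M := fun s => by
    exact_mod_cast rights_add_lefts s M
  have hlefts : ∀ s : ℕ → Bool, lefts s M = M - rights s M := fun s => by
    have := rights_add_lefts s M
    omega
  have hpow : ∀ s : ℕ → Bool, ‖(1 - x) ^ rights s M * (1 + x) ^ lefts s M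
      - (1 - (rights s M - lefts s M) * x)‖ ≤ (M * x) ^ 2 := fun s => by
    have h := abs_pow_mul_pow_sub_le hx0 hx1 (r := rights s M) (l := lefts s M) (by rwa [hsum])
    rw [hsum] at h
    exact h
  have hint : Integrable (fun s => (1 - x) ^ rights s M * (1 + x) ^ lefts s M) (stackLaw ρ) := by
    simpa only [hlefts] using
      integrable_comp_rights (fun r => (1 - x) ^ r * (1 + x) ^ (M - r)) M
  have hint_lin : Integrable (fun s => (rights s M - lefts s M) * x) (stackLaw ρ) := by
    simpa only [hlefts] using integrable_comp_rights (fun r => ((r : ℝ) - (M - r : ℕ)) * x) M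
  have hlin : 1 - (∫ p, ∑ i ∈ Finset.range M, (2 * (p i : ℝ) - 1) ∂ρ) * x
      = ∫ s, (1 - (rights s M - lefts s M) * x) ∂stackLaw ρ := by
    rw [integral_sub (integrable_const _) hint_lin, integral_mul_const,
      integral_rights_sub_lefts_stackLaw]
    simp
  rw [integral_pow_rightsBefore_stackLaw hρ hx0 hx1 hn, ← mul_sub, ← Real.norm_eq_abs,
    norm_mul, Real.norm_of_nonneg (by positivity : 0 ≤ (1 + x)⁻¹ ^ n), hlin,
    ← integral_sub hint (by exact (integrable_const _).sub hint_lin)]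
  refine mul_le_mul_of_nonneg_left ?_ (by positivity)
  simpa only [probReal_univ, mul_one] using
    norm_integral_le_of_norm_le_const (μ := stackLaw ρ) (ae_of_all _ hpow)

lemma hasDrift_stackLaw [IsProbabilityMeasure ρ]
    (hρ : ∀ᵐ p ∂ρ, ∀ i, M ≤ i → (p i : ℝ) = 1 / 2) :
    HasDrift (stackLaw ρ) (∫ p, ∑ i ∈ Finset.range M, (2 * (p i : ℝ) - 1) ∂ρ) := by
  refine ⟨M ^ 2, M + 1, fun n hn u hu => ?_⟩
  have hMu : (M : ℝ) * (u : ℝ)⁻¹ ≤ 1 := by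
    rw [← div_eq_mul_inv]
    exact div_le_one_of_le₀ (by exact_mod_cast (by omega : M ≤ u)) u.cast_nonneg
  have hu1 : (u : ℝ)⁻¹ ≤ 1 := inv_le_one_of_one_le₀ (by exact_mod_cast (by omega : 1 ≤ u))
  rw [← inv_one_add_inv_natCast (by omega), ← mul_pow]
  exact abs_integral_pow_rightsBefore_stackLaw_sub_le hρ (by positivity) hu1 hMu hn

end StackLaw

/-! ### Lyapunov functions of the branching process -/

section Lyapunov

variable {ν : Measure (ℕ → Bool)}

lemma branchingOp_ofReal_tsum [IsFiniteMeasure ν] {f : ℕ → ℕ → ℝ} (hf : ∀ j k, 0 ≤ f j k)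
    {c : ℕ → ℝ} (hfc : ∀ j k, f j k ≤ c j) (hsum : ∀ k, Summable fun j => f j k) (n : ℕ) :
    branchingOp ν (fun k => ENNReal.ofReal (∑' j, f j k)) n
      = ∑' j, ENNReal.ofReal (∫ s, f j (rightsBefore s n) ∂ν) := by
  have hmeas : ∀ j, Measurable fun s => f j (rightsBefore s n) := fun j =>
    (measurable_of_countable (f j)).comp (measurable_rightsBefore n)
  simp only [branchingOp, ENNReal.ofReal_tsum_of_nonneg (hf · _) (hsum _)]
  rw [lintegral_tsum fun j => (hmeas j).ennreal_ofReal.aemeasurable]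
  congr with j
  refine (ofReal_integral_eq_lintegral_ofReal (.of_bound (hmeas j).aestronglyMeasurable (c j)
    (ae_of_all _ fun s => ?_)) (ae_of_all _ fun s => hf j _)).symm
  rw [Real.norm_of_nonneg (hf j _)]
  exact hfc j _

lemma integrable_invCompl_pow [IsFiniteMeasure ν] {u : ℕ} (hu : 0 < u) (n : ℕ) :
    Integrable (fun s => invCompl u ^ rightsBefore s n) ν :=
  .of_bound ((measurable_of_countable (invCompl u ^ ·)).comp
    (measurable_rightsBefore n)).aestronglyMeasurable 1 <| ae_of_all _ fun s => by
      have h0 := invCompl_nonneg hu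
      rw [Real.norm_of_nonneg (pow_nonneg h0 _)]
      exact pow_le_one₀ h0 (invCompl_lt_one hu).le

lemma branchingOp_min_one_le [IsProbabilityMeasure ν] {f : ℕ → ℝ≥0∞} (hf : Antitone f) {N : ℕ}
    (h0 : f N ≠ 0) (htop : f N ≠ ∞) (hfN : ∀ n ≥ N, branchingOp ν f n ≤ f n) :
    branchingOp ν (fun n => min 1 ((f N)⁻¹ * f n)) ≤ fun n => min 1 ((f N)⁻¹ * f n) := fun n => by
  have hle_one : branchingOp ν (fun n => min 1 ((f N)⁻¹ * f n)) n ≤ 1 :=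
    (lintegral_mono fun s => min_le_left _ _).trans (by simp)
  refine le_min hle_one ?_
  rcases le_total N n with hn | hn
  · calc branchingOp ν (fun n => min 1 ((f N)⁻¹ * f n)) n
        ≤ ∫⁻ s, (f N)⁻¹ * f (rightsBefore s n) ∂ν := lintegral_mono fun s => min_le_right _ _
      _ = (f N)⁻¹ * branchingOp ν f n := lintegral_const_mul _
          ((measurable_of_countable f).comp (measurable_rightsBefore n))
      _ ≤ (f N)⁻¹ * f n := by gcongr; exact hfN n hn
  · calc branchingOp ν (fun n => min 1 ((f N)⁻¹ * f n)) n ≤ 1 := hle_one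
      _ = (f N)⁻¹ * f N := (ENNReal.inv_mul_cancel h0 htop).symm
      _ ≤ (f N)⁻¹ * f n := by gcongr; exact hf hn

section Survival

/-- The Lyapunov function of the branching process in the case of survival: a mixture of the
exponential functions `invCompl u ^ n` with the summable weights `u ^ (-b)`, `u ≥ U`. -/
noncomputable def survivalLyapunov (b : ℝ) (U n : ℕ) : ℝ :=
  ∑' j : ℕ, ((j + U : ℕ) : ℝ) ^ (-b) * invCompl (j + U) ^ n

variable {b δ : ℝ} {U : ℕ}

lemma rpow_neg_mul_one_sub_le {u : ℕ} (hu : 0 < u) (hb : 1 ≤ b) :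
    (u : ℝ) ^ (-b) * (1 - b * (u : ℝ)⁻¹) ≤ ((u + 1 : ℕ) : ℝ) ^ (-b) := by
  have hu0 : (0 : ℝ) < u := by exact_mod_cast hu
  have hbern : 1 - b * (u : ℝ)⁻¹ ≤ ((u : ℝ) / (u + 1)) ^ b := calc
    1 - b * (u : ℝ)⁻¹ ≤ 1 + b * -((u : ℝ) + 1)⁻¹ := by
        have : ((u : ℝ) + 1)⁻¹ ≤ (u : ℝ)⁻¹ := inv_anti₀ hu0 (by linarith)
        nlinarith
    _ ≤ (1 + -((u : ℝ) + 1)⁻¹) ^ b := one_add_mul_self_le_rpow_one_add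
        (neg_le_neg (inv_le_one_of_one_le₀ (by linarith))) hb
    _ = ((u : ℝ) / (u + 1)) ^ b := by
        congr 1
        field_simp
        ring
  calc (u : ℝ) ^ (-b) * (1 - b * (u : ℝ)⁻¹) ≤ (u : ℝ) ^ (-b) * ((u : ℝ) / (u + 1)) ^ b := by gcongr
    _ = ((u + 1 : ℕ) : ℝ) ^ (-b) := by
        rw [Real.div_rpow hu0.le (by positivity), Real.rpow_neg hu0.le,
          Real.rpow_neg (Nat.cast_nonneg _)]
        push_cast
        field_simp

lemma HasDrift.exists_rpow_mul_integral_le (h : HasDrift ν δ) (hb : 1 ≤ b) (hbδ : b < δ) :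
    ∃ N : ℕ, ∀ n ≥ N, ∀ u ≥ N, (u : ℝ) ^ (-b) * ∫ s, invCompl u ^ rightsBefore s n ∂ν
      ≤ ((u + 1 : ℕ) : ℝ) ^ (-b) * invCompl (u + 1) ^ n := by
  obtain ⟨C, N, hN⟩ := h
  have hC : ∀ᶠ u : ℕ in atTop, C * (u : ℝ)⁻¹ < δ - b := by
    have hlim := (tendsto_inv_atTop_nhds_zero_nat (𝕜 := ℝ)).const_mul C
    rw [mul_zero] at hlim
    exact hlim.eventually_lt_const (sub_pos.2 hbδ)
  obtain ⟨N', hN'⟩ := eventually_atTop.1 hC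
  refine ⟨max (max N N') 1, fun n hn u hu => ?_⟩
  simp only [ge_iff_le, max_le_iff] at hn hu
  have hq := pow_nonneg (invCompl_nonneg (Nat.succ_pos u)) n
  have hx : (0 : ℝ) ≤ (u : ℝ)⁻¹ := by positivity
  have hint := (abs_sub_le_iff.1 (hN n hn.1.1 u hu.1.1)).1
  calc (u : ℝ) ^ (-b) * ∫ s, invCompl u ^ rightsBefore s n ∂ν
      ≤ (u : ℝ) ^ (-b) * (invCompl (u + 1) ^ n * (1 - b * (u : ℝ)⁻¹)) := by
        gcongr
        nlinarith [mul_nonneg hq (mul_nonneg hx (sub_nonneg.2 (hN' u hu.1.2).le))]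
    _ = (u : ℝ) ^ (-b) * (1 - b * (u : ℝ)⁻¹) * invCompl (u + 1) ^ n := by ring
    _ ≤ _ := by
        gcongr
        exact rpow_neg_mul_one_sub_le hu.2 hb

lemma rpow_mul_invCompl_pow_nonneg {u : ℕ} (hu : 0 < u) (n : ℕ) :
    0 ≤ (u : ℝ) ^ (-b) * invCompl u ^ n :=
  mul_nonneg (by positivity) (pow_nonneg (invCompl_nonneg hu) n)

lemma rpow_mul_invCompl_pow_le {u : ℕ} (hu : 0 < u) (n : ℕ) :
    (u : ℝ) ^ (-b) * invCompl u ^ n ≤ (u : ℝ) ^ (-b) :=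
  mul_le_of_le_one_right (by positivity)
    (pow_le_one₀ (invCompl_nonneg hu) (invCompl_lt_one hu).le)

lemma summable_natCast_add_rpow_neg (hb : 1 < b) (U : ℕ) :
    Summable fun j : ℕ => ((j + U : ℕ) : ℝ) ^ (-b) :=
  (summable_nat_add_iff U).2 (Real.summable_nat_rpow.2 (by linarith))

lemma summable_survivalLyapunov (hb : 1 < b) (hU : 0 < U) (n : ℕ) :
    Summable fun j : ℕ => ((j + U : ℕ) : ℝ) ^ (-b) * invCompl (j + U) ^ n :=
  .of_nonneg_of_le (fun j => rpow_mul_invCompl_pow_nonneg (by omega) n)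
    (fun j => rpow_mul_invCompl_pow_le (by omega) n) (summable_natCast_add_rpow_neg hb U)

lemma antitone_survivalLyapunov (hb : 1 < b) (hU : 0 < U) : Antitone (survivalLyapunov b U) :=
  fun m n hmn => (summable_survivalLyapunov hb hU n).tsum_le_tsum (fun j => by
    have hj : 0 < j + U := by omega
    exact mul_le_mul_of_nonneg_left
      (pow_le_pow_of_le_one (invCompl_nonneg hj) (invCompl_lt_one hj).le hmn) (by positivity))
    (summable_survivalLyapunov hb hU m)

lemma survivalLyapunov_pos (hb : 1 < b) (hU : 1 < U) (n : ℕ) : 0 < survivalLyapunov b U n :=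
  (summable_survivalLyapunov hb (by omega) n).tsum_pos
    (fun j => rpow_mul_invCompl_pow_nonneg (by omega) n) 0
    (mul_pos (Real.rpow_pos_of_pos (by positivity) _) (pow_pos (invCompl_pos (by omega)) n))

lemma tendsto_survivalLyapunov (hb : 1 < b) (hU : 0 < U) :
    Tendsto (survivalLyapunov b U) atTop (nhds 0) := by
  have hterm : ∀ j : ℕ, Tendsto (fun n => ((j + U : ℕ) : ℝ) ^ (-b) * invCompl (j + U) ^ n) atTop
      (nhds 0) := fun j => by
    have hj : 0 < j + U := by omega
    have hpow := (tendsto_pow_atTop_nhds_zero_of_lt_one (invCompl_nonneg hj)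
      (invCompl_lt_one hj)).const_mul (((j + U : ℕ) : ℝ) ^ (-b))
    rwa [mul_zero] at hpow
  have hlim := tendsto_tsum_of_dominated_convergence (summable_natCast_add_rpow_neg hb U) hterm
    (.of_forall fun n j => by
      rw [Real.norm_of_nonneg (rpow_mul_invCompl_pow_nonneg (by omega) n)]
      exact rpow_mul_invCompl_pow_le (by omega) n)
  rwa [tsum_zero] at hlim

lemma HasDrift.exists_branchingOp_survivalLyapunov_le [IsFiniteMeasure ν] (h : HasDrift ν δ)
    (hb : 1 < b) (hbδ : b < δ) : ∃ U : ℕ, 1 < U ∧ ∀ n ≥ U,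
      branchingOp ν (fun k => ENNReal.ofReal (survivalLyapunov b U k)) n
        ≤ ENNReal.ofReal (survivalLyapunov b U n) := by
  obtain ⟨N, hN⟩ := h.exists_rpow_mul_integral_le hb.le hbδ
  refine ⟨max N 2, by simp, fun n hn => ?_⟩
  set U := max N 2
  have hU : 0 < U := by omega
  let f : ℕ → ℕ → ℝ := fun j k => ((j + U : ℕ) : ℝ) ^ (-b) * invCompl (j + U) ^ k
  have hf : ∀ j k, 0 ≤ f j k := fun j k => rpow_mul_invCompl_pow_nonneg (by omega) k
  calc branchingOp ν (fun k => ENNReal.ofReal (survivalLyapunov b U k)) n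
      = ∑' j, ENNReal.ofReal (∫ s, f j (rightsBefore s n) ∂ν) := branchingOp_ofReal_tsum hf
        (fun j k => rpow_mul_invCompl_pow_le (by omega) k) (summable_survivalLyapunov hb hU) n
    _ ≤ ∑' j, ENNReal.ofReal (f (j + 1) n) := by
        refine ENNReal.tsum_le_tsum fun j => ENNReal.ofReal_le_ofReal ?_
        rw [integral_const_mul]
        simpa only [f, add_right_comm] using hN n (by omega) (j + U) (by omega)
    _ ≤ ∑' j, ENNReal.ofReal (f j n) := ENNReal.tsum_comp_le_tsum_of_injective
        (add_left_injective 1) fun j => ENNReal.ofReal (f j n)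
    _ = ENNReal.ofReal (survivalLyapunov b U n) :=
        (ENNReal.ofReal_tsum_of_nonneg (hf · n) (summable_survivalLyapunov hb hU n)).symm

lemma HasDrift.exists_supersolution_tendsto_zero [IsProbabilityMeasure ν] (h : HasDrift ν δ)
    (hδ : 1 < δ) :
    ∃ g : ℕ → ℝ≥0∞, 1 ≤ g 0 ∧ branchingOp ν g ≤ g ∧ Tendsto g atTop (nhds 0) := by
  obtain ⟨b, hb, hbδ⟩ := exists_between hδ
  obtain ⟨U, hU, hle⟩ := h.exists_branchingOp_survivalLyapunov_le hb hbδ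
  let f : ℕ → ℝ≥0∞ := fun n => ENNReal.ofReal (survivalLyapunov b U n)
  have hf : Antitone f := fun _ _ hmn =>
    ENNReal.ofReal_le_ofReal (antitone_survivalLyapunov hb (by omega) hmn)
  have hfU : f U ≠ 0 := (ENNReal.ofReal_pos.2 (survivalLyapunov_pos hb hU U)).ne'
  refine ⟨fun n => min 1 ((f U)⁻¹ * f n), le_min le_rfl ?_,
    branchingOp_min_one_le hf hfU ENNReal.ofReal_ne_top hle, ?_⟩
  · rw [← ENNReal.inv_mul_cancel hfU ENNReal.ofReal_ne_top]
    gcongr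
    exact hf (Nat.zero_le U)
  · have hlim := ENNReal.Tendsto.const_mul
      (ENNReal.tendsto_ofReal (tendsto_survivalLyapunov hb (by omega : 0 < U)))
      (.inr (ENNReal.inv_ne_top.2 hfU))
    rw [ENNReal.ofReal_zero, mul_zero] at hlim
    exact tendsto_of_tendsto_of_tendsto_of_le_of_le tendsto_const_nhds hlim (fun _ => zero_le)
      fun _ => min_le_right _ _

end Survival

section Extinction

/-- The Lyapunov function of the branching process in the case of extinction: a mixture of the
functions `1 - invCompl u ^ n`, `u ≥ U`, with the harmonic weights `u⁻¹`. It grows like `log n`. -/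
noncomputable def extinctionLyapunov (U n : ℕ) : ℝ :=
  ∑' j : ℕ, ((j + U : ℕ) : ℝ)⁻¹ * (1 - invCompl (j + U) ^ n)

variable {δ : ℝ} {U : ℕ}

lemma inv_mul_one_sub_invCompl_pow_nonneg {u : ℕ} (hu : 0 < u) (n : ℕ) :
    0 ≤ (u : ℝ)⁻¹ * (1 - invCompl u ^ n) :=
  mul_nonneg (by positivity)
    (sub_nonneg.2 (pow_le_one₀ (invCompl_nonneg hu) (invCompl_lt_one hu).le))

lemma inv_mul_one_sub_invCompl_pow_le {u : ℕ} (hu : 0 < u) (n : ℕ) :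
    (u : ℝ)⁻¹ * (1 - invCompl u ^ n) ≤ (u : ℝ)⁻¹ :=
  mul_le_of_le_one_right (by positivity) (sub_le_self _ (pow_nonneg (invCompl_nonneg hu) n))

lemma extinctionLyapunov_nonneg (hU : 0 < U) (n : ℕ) : 0 ≤ extinctionLyapunov U n :=
  tsum_nonneg fun j => inv_mul_one_sub_invCompl_pow_nonneg (by omega) n

lemma summable_extinctionLyapunov (hU : 0 < U) (n : ℕ) :
    Summable fun j : ℕ => ((j + U : ℕ) : ℝ)⁻¹ * (1 - invCompl (j + U) ^ n) := by
  have hsum : Summable fun j : ℕ => n * (((j + U : ℕ) : ℝ) ^ 2)⁻¹ :=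
    ((summable_nat_add_iff U).2 (Real.summable_nat_pow_inv.2 one_lt_two)).mul_left _
  refine hsum.of_nonneg_of_le (fun j => inv_mul_one_sub_invCompl_pow_nonneg (by omega) n)
    fun j => ?_
  have hbern : 1 + n * (invCompl (j + U) - 1) ≤ invCompl (j + U) ^ n := one_add_mul_sub_le_pow
    (neg_one_lt_zero.le.trans (invCompl_nonneg (by omega))) n
  calc ((j + U : ℕ) : ℝ)⁻¹ * (1 - invCompl (j + U) ^ n)
      ≤ ((j + U : ℕ) : ℝ)⁻¹ * (n * ((j + U : ℕ) : ℝ)⁻¹) := by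
        refine mul_le_mul_of_nonneg_left ?_ (by positivity)
        rw [show invCompl (j + U) - 1 = -((j + U : ℕ) : ℝ)⁻¹ from sub_sub_cancel_left _ _] at hbern
        linarith
    _ = n * (((j + U : ℕ) : ℝ) ^ 2)⁻¹ := by ring

lemma tendsto_extinctionLyapunov (hU : 0 < U) :
    Tendsto (extinctionLyapunov U) atTop atTop := by
  have hharm : Tendsto (fun J => ∑ j ∈ Finset.range J, ((j + U : ℕ) : ℝ)⁻¹) atTop atTop :=
    (not_summable_iff_tendsto_nat_atTop_of_nonneg fun j => by positivity).1
      (mt (summable_nat_add_iff (f := fun u : ℕ => (u : ℝ)⁻¹) U).1 Real.not_summable_natCast_inv)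
  refine tendsto_atTop.2 fun A => ?_
  obtain ⟨J, hJ⟩ := (hharm.eventually_gt_atTop A).exists
  have hlim : Tendsto (fun n => ∑ j ∈ Finset.range J,
      ((j + U : ℕ) : ℝ)⁻¹ * (1 - invCompl (j + U) ^ n)) atTop
      (nhds (∑ j ∈ Finset.range J, ((j + U : ℕ) : ℝ)⁻¹ * (1 - 0))) :=
    tendsto_finsetSum _ fun j _ => ((tendsto_pow_atTop_nhds_zero_of_lt_one
      (invCompl_nonneg (by omega)) (invCompl_lt_one (by omega))).const_sub 1).const_mul _
  simp only [sub_zero, mul_one] at hlim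
  filter_upwards [hlim.eventually_const_lt hJ] with n hn
  exact hn.le.trans ((summable_extinctionLyapunov hU n).sum_le_tsum _
    fun j _ => inv_mul_one_sub_invCompl_pow_nonneg (by omega) n)

lemma HasDrift.exists_inv_mul_integral_ge (h : HasDrift ν δ) (hδ : δ < 1) :
    ∃ ε > 0, ∃ N : ℕ, ∀ n ≥ N, ∀ u ≥ N,
      ((u + 1 : ℕ) : ℝ)⁻¹ * invCompl (u + 1) ^ n + ε * (u : ℝ)⁻¹ ^ 2 * invCompl (u + 1) ^ n
        ≤ (u : ℝ)⁻¹ * ∫ s, invCompl u ^ rightsBefore s n ∂ν := by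
  obtain ⟨C, N, hN⟩ := h
  have hC : ∀ᶠ u : ℕ in atTop, (C + 1) * (u : ℝ)⁻¹ < (1 - δ) / 2 := by
    have hlim := (tendsto_inv_atTop_nhds_zero_nat (𝕜 := ℝ)).const_mul (C + 1)
    rw [mul_zero] at hlim
    exact hlim.eventually_lt_const (by linarith)
  obtain ⟨N', hN'⟩ := eventually_atTop.1 hC
  refine ⟨(1 - δ) / 2, by linarith, max (max N N') 1, fun n hn u hu => ?_⟩
  simp only [ge_iff_le, max_le_iff] at hn hu
  have hint := (abs_sub_le_iff.1 (hN n hn.1.1 u hu.1.1)).2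
  have hweight : ((u + 1 : ℕ) : ℝ)⁻¹ ≤ (u : ℝ)⁻¹ - (u : ℝ)⁻¹ ^ 2 + (u : ℝ)⁻¹ ^ 3 := by
    have hu0 : (0 : ℝ) < u := by exact_mod_cast hu.2
    rw [Nat.cast_succ, ← sub_nonneg,
      show (u : ℝ)⁻¹ - (u : ℝ)⁻¹ ^ 2 + (u : ℝ)⁻¹ ^ 3 - ((u : ℝ) + 1)⁻¹
        = (u : ℝ)⁻¹ ^ 3 * ((u : ℝ) + 1)⁻¹ by field_simp; ring]
    positivity
  have hq := pow_nonneg (invCompl_nonneg (Nat.succ_pos u)) n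
  set x := (u : ℝ)⁻¹
  have : 0 ≤ x := by positivity
  calc ((u + 1 : ℕ) : ℝ)⁻¹ * invCompl (u + 1) ^ n
        + (1 - δ) / 2 * x ^ 2 * invCompl (u + 1) ^ n
      ≤ (x - x ^ 2 + x ^ 3 + (1 - δ) / 2 * x ^ 2) * invCompl (u + 1) ^ n := by
        rw [← add_mul]
        gcongr
    _ ≤ x * (1 - δ * x - C * x ^ 2) * invCompl (u + 1) ^ n := by
        gcongr
        nlinarith [mul_nonneg (sq_nonneg x) (sub_nonneg.2 (hN' u hu.1.2).le)]
    _ = x * (invCompl (u + 1) ^ n * (1 - δ * x) - invCompl (u + 1) ^ n * (C * x ^ 2)) := by ring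
    _ ≤ _ := by gcongr; linarith

lemma eventually_mul_invCompl_pow_le (hU : 0 < U) (a : ℝ) {c : ℝ} (hc : 0 < c) :
    ∀ᶠ n in atTop, a * invCompl U ^ n ≤ c * invCompl (U + 1) ^ n := by
  have hpos : 0 < invCompl (U + 1) := invCompl_pos (by omega)
  have hlt : invCompl U < invCompl (U + 1) := by
    simp only [invCompl, Nat.cast_succ]
    gcongr
    linarith
  have hlim := (tendsto_pow_atTop_nhds_zero_of_lt_one (div_nonneg (invCompl_nonneg hU) hpos.le)
    ((div_lt_one hpos).2 hlt)).const_mul a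
  rw [mul_zero] at hlim
  filter_upwards [hlim.eventually_lt_const hc] with n hn
  rw [div_pow, ← mul_div_assoc, div_lt_iff₀ (pow_pos hpos n)] at hn
  exact hn.le

lemma HasDrift.exists_sum_inv_mul_le (h : HasDrift ν δ) (hδ : δ < 1) :
    ∃ U > 0, ∃ N, ∀ n ≥ N, ∀ J,
      ∑ j ∈ Finset.range J,
          ((j + U : ℕ) : ℝ)⁻¹ * (1 - ∫ s, invCompl (j + U) ^ rightsBefore s n ∂ν)
        ≤ ∑ j ∈ Finset.range J, ((j + U : ℕ) : ℝ)⁻¹ * (1 - invCompl (j + U) ^ n) := by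
  obtain ⟨ε, hε, N, hdrift⟩ := h.exists_inv_mul_integral_ge hδ
  set U := N + 1
  have hU : 0 < U := Nat.succ_pos N
  obtain ⟨N', hN'⟩ := eventually_atTop.1 (eventually_mul_invCompl_pow_le hU (U : ℝ)⁻¹
    (by positivity : 0 < ε * (U : ℝ)⁻¹ ^ 2))
  refine ⟨U, hU, max N N', fun n hn J => ?_⟩
  let g : ℕ → ℝ := fun j => ((j + U : ℕ) : ℝ)⁻¹ * invCompl (j + U) ^ n
  let e : ℕ → ℝ := fun j => ε * ((j + U : ℕ) : ℝ)⁻¹ ^ 2 * invCompl (j + U + 1) ^ n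
  have hg : ∀ j, 0 ≤ g j := fun j =>
    mul_nonneg (by positivity) (pow_nonneg (invCompl_nonneg (by omega)) n)
  have he : ∀ j, 0 ≤ e j := fun j =>
    mul_nonneg (by positivity) (pow_nonneg (invCompl_nonneg (by omega)) n)
  have hterm : ∀ j, ((j + U : ℕ) : ℝ)⁻¹ * (1 - ∫ s, invCompl (j + U) ^ rightsBefore s n ∂ν)
      ≤ ((j + U : ℕ) : ℝ)⁻¹ * (1 - invCompl (j + U) ^ n) - (g (j + 1) - g j) - e j := fun j => by
    have hj := hdrift n (le_of_max_le_left hn) (j + U) (by omega)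
    simp only [g, e, add_right_comm j 1 U]
    linarith
  have htel : 0 ≤ (∑ j ∈ Finset.range J, (g (j + 1) - g j)) + ∑ j ∈ Finset.range J, e j := by
    rcases J.eq_zero_or_pos with rfl | hJ
    · simp
    have h0 : g 0 ≤ e 0 := by simpa [g, e] using hN' n (le_of_max_le_right hn)
    have h0J := Finset.single_le_sum (f := e) (fun j _ => he j) (Finset.mem_range.2 hJ)
    rw [Finset.sum_range_sub]
    linarith [hg J]
  have hsum := Finset.sum_le_sum fun j (_ : j ∈ Finset.range J) => hterm j
  simp only [Finset.sum_sub_distrib] at hsum htel ⊢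
  linarith

lemma HasDrift.exists_tendsto_atTop_supersolution [IsProbabilityMeasure ν] (h : HasDrift ν δ)
    (hδ : δ < 1) : ∃ L : ℕ → ℝ, (∀ n, 0 ≤ L n) ∧ Tendsto L atTop atTop ∧ ∃ N, ∀ n ≥ N,
      branchingOp ν (fun k => ENNReal.ofReal (L k)) n ≤ ENNReal.ofReal (L n) := by
  obtain ⟨U, hU, N, hle⟩ := h.exists_sum_inv_mul_le hδ
  refine ⟨extinctionLyapunov U, extinctionLyapunov_nonneg hU, tendsto_extinctionLyapunov hU, N,
    fun n hn => ?_⟩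
  let f : ℕ → ℕ → ℝ := fun j k => ((j + U : ℕ) : ℝ)⁻¹ * (1 - invCompl (j + U) ^ k)
  have hf : ∀ j k, 0 ≤ f j k := fun j k => inv_mul_one_sub_invCompl_pow_nonneg (by omega) k
  have hint : ∀ j, ∫ s, f j (rightsBefore s n) ∂ν
      = ((j + U : ℕ) : ℝ)⁻¹ * (1 - ∫ s, invCompl (j + U) ^ rightsBefore s n ∂ν) := fun j => by
    rw [integral_const_mul, integral_sub (integrable_const _)
      (integrable_invCompl_pow (by omega) n)]
    simp
  calc branchingOp ν (fun k => ENNReal.ofReal (extinctionLyapunov U k)) n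
      = ∑' j, ENNReal.ofReal (∫ s, f j (rightsBefore s n) ∂ν) := branchingOp_ofReal_tsum hf
        (fun j k => inv_mul_one_sub_invCompl_pow_le (by omega) k)
        (summable_extinctionLyapunov hU) n
    _ ≤ ENNReal.ofReal (extinctionLyapunov U n) := by
        refine ENNReal.tsum_le_of_sum_range_le fun J => ?_
        rw [← ENNReal.ofReal_sum_of_nonneg fun j _ => integral_nonneg fun s => hf j _]
        refine ENNReal.ofReal_le_ofReal ?_
        simp only [hint]
        exact (hle n hn J).trans
          ((summable_extinctionLyapunov hU n).sum_le_tsum _ fun j _ => hf j n)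

end Extinction

end Lyapunov

section StackLaw

variable {ρ : Measure (ℕ → unitInterval)} [IsProbabilityMeasure ρ] {M : ℕ} {Ω : Type*}
  [MeasurableSpace Ω] {μ : Measure Ω} {σ : ℕ → Ω → ℕ → Bool}

lemma ae_exists_branching_eq_zero_of_drift_lt_one
    (hρ : ∀ᵐ p ∂ρ, ∀ i, M ≤ i → (p i : ℝ) = 1 / 2)
    (hell : 0 < ρ {p | ∀ i, (p i : ℝ) < 1})
    (hδ : ∫ p, ∑ i ∈ Finset.range M, (2 * (p i : ℝ) - 1) ∂ρ < 1)
    (hind : iIndepFun σ μ) (hm : ∀ k, Measurable (σ k)) (hσ : ∀ k, μ.map (σ k) = stackLaw ρ)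
    (m : ℕ) : ∀ᵐ ω ∂μ, ∃ k, branching (fun k => σ k ω) m k = 0 := by
  obtain ⟨L, hL, hLtop, N, hLsup⟩ := (hasDrift_stackLaw hρ).exists_tendsto_atTop_supersolution hδ
  exact ae_exists_branching_eq_zero hind hm hσ (stackLaw_rightsBefore_eq_zero_pos hell) hL hLtop
    hLsup m

lemma ae_exists_forall_branching_ne_zero_of_one_lt_drift
    (hρ : ∀ᵐ p ∂ρ, ∀ i, M ≤ i → (p i : ℝ) = 1 / 2)
    (hδ : 1 < ∫ p, ∑ i ∈ Finset.range M, (2 * (p i : ℝ) - 1) ∂ρ)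
    (hind : iIndepFun σ μ) (hm : ∀ k, Measurable (σ k)) (hσ : ∀ k, μ.map (σ k) = stackLaw ρ) :
    ∀ᵐ ω ∂μ, ∃ m, ∀ k, branching (fun k => σ k ω) m k ≠ 0 := by
  obtain ⟨g, hg0, hg, hlim⟩ := (hasDrift_stackLaw hρ).exists_supersolution_tendsto_zero hδ
  have hle : ∀ m, μ {ω | ∀ m, ∃ k, branching (fun k => σ k ω) m k = 0} ≤ g m := fun m =>
    (measure_mono fun ω (hω : ∀ m, ∃ k, branching (fun k => σ k ω) m k = 0) => hω m).trans
      (measure_exists_branching_eq_zero_le hind hm hσ hg0 hg m)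
  have hzero := le_antisymm (ge_of_tendsto' hlim hle) zero_le
  rw [ae_iff, ← hzero]
  simp only [not_exists, not_forall, not_not]

end StackLaw

/-! ### The law of the walk -/

/-- The position and the local times of the walk started at `x` which follows the arrows `η`. -/
def walkState (η : ℤ → ℕ → Bool) (x : ℤ) : ℕ → ℤ × (ℤ → ℕ)
  | 0 => (x, fun _ => 0)
  | n + 1 =>
    ((walkState η x n).1
        + arrowSign (η (walkState η x n).1 ((walkState η x n).2 (walkState η x n).1)),
      fun z => (walkState η x n).2 z + if (walkState η x n).1 = z then 1 else 0)

/-- The walk started at `x` which follows the arrows `η`. -/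
def stackWalk (x : ℤ) (η : ℤ → ℕ → Bool) (n : ℕ) : ℤ := (walkState η x n).1

lemma walkState_snd (η : ℤ → ℕ → Bool) (x : ℤ) (n : ℕ) (z : ℤ) :
    (walkState η x n).2 z = visits (stackWalk x η) n z := by
  induction n with
  | zero => simp [walkState]
  | succ n ih => rw [visits_succ, ← ih]; rfl

lemma isStackWalk_stackWalk (η : ℤ → ℕ → Bool) (x : ℤ) : IsStackWalk η x (stackWalk x η) where
  start := rfl
  step n := by rw [← walkState_snd]; rfl

lemma measurable_walkState (x : ℤ) (n : ℕ) :
    Measurable fun η : ℤ → ℕ → Bool => walkState η x n := by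
  induction n with
  | zero => exact measurable_const
  | succ n ih =>
    have hlocal : Measurable fun η : ℤ → ℕ → Bool => (walkState η x n).2 (walkState η x n).1 :=
      (measurable_from_prod_countable_left (f := fun q : (ℤ → ℕ) × ℤ => q.1 q.2)
        fun z => measurable_pi_apply z).comp (ih.snd.prodMk ih.fst)
    have harrow : Measurable fun η : ℤ → ℕ → Bool =>
        η (walkState η x n).1 ((walkState η x n).2 (walkState η x n).1) :=
      (measurable_from_prod_countable_left
        (f := fun q : (ℤ → ℕ → Bool) × (ℤ × ℕ) => q.1 q.2.1 q.2.2) fun v =>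
          (measurable_pi_apply v.2).comp (measurable_pi_apply v.1)).comp
        (measurable_id.prodMk (ih.fst.prodMk hlocal))
    exact (ih.fst.add ((measurable_of_countable arrowSign).comp harrow)).prodMk
      (measurable_pi_iff.2 fun z => ((measurable_pi_apply z).comp ih.snd).add
        ((measurable_of_countable fun y : ℤ => if y = z then 1 else 0).comp ih.fst))

lemma measurable_stackWalk (x : ℤ) : Measurable (stackWalk x) :=
  measurable_pi_iff.2 fun n => (measurable_walkState x n).fst

/-- The arrows which lead along the first `n` steps of the path `a`. -/
def pathEvent (a : ℕ → ℤ) (n : ℕ) : Set (ℤ → ℕ → Bool) :=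
  {η | ∀ j < n, arrowSign (η (a j) (visits a j (a j))) = a (j + 1) - a j}

lemma stackWalk_eq_iff (x : ℤ) (η : ℤ → ℕ → Bool) (a : ℕ → ℤ) (n : ℕ) :
    (∀ i ≤ n, stackWalk x η i = a i) ↔ a 0 = x ∧ η ∈ pathEvent a n := by
  have hw := isStackWalk_stackWalk η x
  constructor
  · intro h
    refine ⟨by rw [← h 0 n.zero_le, hw.start], fun j hj => ?_⟩
    rw [← visits_congr fun i hi => h i (by omega), ← h j hj.le, ← h (j + 1) hj, hw.step,
      add_sub_cancel_left]
  · rintro ⟨h0, h⟩ i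
    induction i using Nat.strong_induction_on with
    | _ i ih =>
      intro hi
      cases i with
      | zero => rw [hw.start, h0]
      | succ i =>
        rw [hw.step, ih i (by omega) (by omega),
          visits_congr fun j hj => ih j (by omega) (by omega), h i hi, add_sub_cancel]

/-- The probability that a cookie of strength `p` causes the displacement `d`. -/
noncomputable def stepWeight (p : unitInterval) (d : ℤ) : ℝ≥0∞ :=
  ∑ b with arrowSign b = d, cookieWeight p b

lemma stepWeight_one (p : unitInterval) : stepWeight p 1 = ENNReal.ofReal p := by
  simp [stepWeight, Finset.sum_filter, arrowSign, cookieWeight]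

lemma stepWeight_neg_one (p : unitInterval) : stepWeight p (-1) = ENNReal.ofReal (1 - p) := by
  simp [stepWeight, Finset.sum_filter, arrowSign, cookieWeight]

lemma stepWeight_eq_zero (p : unitInterval) {d : ℤ} (h1 : d ≠ 1) (h2 : d ≠ -1) :
    stepWeight p d = 0 := by
  rw [stepWeight, Finset.sum_filter]
  simp [arrowSign, h1.symm, h2.symm]

lemma measurable_stepWeight (d : ℤ) : Measurable fun p => stepWeight p d := by
  refine Finset.measurable_sum _ fun b _ => ?_
  cases b
  · exact (measurable_const.sub measurable_subtype_coe).ennreal_ofReal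
  · exact measurable_subtype_coe.ennreal_ofReal

lemma uniformSeq_arrowSign_stackOf (p : ℕ → unitInterval) (i : ℕ) (d : ℤ) :
    uniformSeq {u | arrowSign (stackOf p u i) = d} = stepWeight (p i) d := by
  have hpre : {u | arrowSign (stackOf p u i) = d}
      = (fun u => stackOf p u i) ⁻¹' ↑(Finset.univ.filter fun b => arrowSign b = d) := by
    ext u
    simp
  rw [hpre, ← sum_measure_preimage_singleton _ fun b _ =>
    measurable_stackOf_apply p i (measurableSet_singleton b)]
  simp only [uniformSeq_stackOf_preimage, stepWeight]

lemma visits_injective (a : ℕ → ℤ) (z : ℤ) :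
    Function.Injective fun j : {j // a j = z} => visits a j z :=
  fun i j hij => Subtype.ext (Nat.count_injective i.2 j.2 hij)

/-- The stacks at the site `z` which lead along the first `n` steps of the path `a`. -/
def siteEvent (a : ℕ → ℤ) (n : ℕ) (z : ℤ) : Set (ℕ → Bool) :=
  {s | ∀ j < n, a j = z → arrowSign (s (visits a j z)) = a (j + 1) - a j}

/-- The probability, given the cookies `p` at the site `z`, of the steps which the path `a` takes
at `z` before time `n`. -/
noncomputable def siteWeight (a : ℕ → ℤ) (n : ℕ) (z : ℤ) (p : ℕ → unitInterval) : ℝ≥0∞ :=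
  ∏ j ∈ Finset.range n with a j = z, stepWeight (p (visits a j z)) (a (j + 1) - a j)

lemma measurableSet_siteEvent (a : ℕ → ℤ) (n : ℕ) (z : ℤ) : MeasurableSet (siteEvent a n z) := by
  simp only [siteEvent, Set.ofPred_forall]
  exact .iInter fun j => .iInter fun _ => .iInter fun _ => measurableSet_eq_fun
    ((measurable_of_countable arrowSign).comp (measurable_pi_apply _)) measurable_const

lemma measurable_siteWeight (a : ℕ → ℤ) (n : ℕ) (z : ℤ) : Measurable (siteWeight a n z) :=
  Finset.measurable_prod _ fun _ _ => (measurable_stepWeight _).comp (measurable_pi_apply _)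

lemma uniformSeq_siteEvent (p : ℕ → unitInterval) (a : ℕ → ℤ) (n : ℕ) (z : ℤ) :
    uniformSeq {u | stackOf p u ∈ siteEvent a n z} = siteWeight a n z p := by
  have hinter : {u | stackOf p u ∈ siteEvent a n z}
      = ⋂ j ∈ (Finset.range n).subtype fun j => a j = z,
        {u | arrowSign (stackOf p u (visits a j z)) = a (j + 1) - a j} := by
    ext u
    simp only [siteEvent, Set.mem_ofPred_eq, Set.mem_iInter, Finset.mem_subtype, Finset.mem_range,
      Subtype.forall]
    exact forall_congr' fun j => forall_comm
  have hindep := ((iIndepFun_stackOf p).precomp (visits_injective a z)).meas_biInter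
    (S := (Finset.range n).subtype fun j => a j = z)
    (s := fun j => {u | arrowSign (stackOf p u (visits a j z)) = a (j + 1) - a j})
    fun j _ => ⟨{b | arrowSign b = a (j + 1) - a j}, .of_discrete, rfl⟩
  rw [hinter, hindep]
  simp only [uniformSeq_arrowSign_stackOf]
  exact Finset.prod_subtype_eq_prod_filter
    fun j => stepWeight (p (visits a j z)) (a (j + 1) - a j)

lemma stackLaw_siteEvent (ρ : Measure (ℕ → unitInterval)) (a : ℕ → ℤ) (n : ℕ) (z : ℤ) :
    stackLaw ρ (siteEvent a n z) = ∫⁻ p, siteWeight a n z p ∂ρ := by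
  have hm := measurableSet_siteEvent a n z
  simp_rw [← lintegral_indicator_one hm, ← uniformSeq_siteEvent]
  rw [lintegral_stackLaw ρ (measurable_one.indicator hm)]
  refine lintegral_congr fun p => ?_
  exact lintegral_indicator_one ((measurable_stackOf.comp measurable_prodMk_left) hm)

/-- The law of the arrows: the stacks at the different sites are independent with law
`stackLaw ρ`. -/
noncomputable def arrowLaw (ρ : Measure (ℕ → unitInterval)) : Measure (ℤ → ℕ → Bool) :=
  Measure.infinitePi fun _ : ℤ => stackLaw ρ

section ArrowLaw

variable (ρ : Measure (ℕ → unitInterval)) [IsProbabilityMeasure ρ]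

instance : IsProbabilityMeasure (arrowLaw ρ) := by unfold arrowLaw; infer_instance

lemma arrowLaw_map_eval (z : ℤ) : (arrowLaw ρ).map (fun η => η z) = stackLaw ρ :=
  Measure.infinitePi_map_eval (fun _ : ℤ => stackLaw ρ) z

lemma iIndepFun_arrowLaw : iIndepFun (fun (z : ℤ) (η : ℤ → ℕ → Bool) => η z) (arrowLaw ρ) :=
  iIndepFun_infinitePi (X := fun _ s => s) fun _ => measurable_id

variable {ρ} in
lemma ae_goodStack_arrowLaw {M : ℕ} (hρ : ∀ᵐ p ∂ρ, ∀ i, M ≤ i → (p i : ℝ) = 1 / 2) :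
    ∀ᵐ η ∂arrowLaw ρ, ∀ z, GoodStack (η z) :=
  ae_all_iff.2 fun z => (measurePreserving_eval_infinitePi (fun _ : ℤ => stackLaw ρ)
    z).quasiMeasurePreserving.ae (ae_goodStack_stackLaw hρ)

end ArrowLaw

lemma pathEvent_eq_pi (a : ℕ → ℤ) (n : ℕ) :
    pathEvent a n = Set.pi ((Finset.range n).image a : Finset ℤ) (siteEvent a n) := by
  ext η
  simp only [pathEvent, siteEvent, Set.mem_pi, Set.mem_ofPred_eq, Finset.mem_coe,
    Finset.mem_image, Finset.mem_range]
  constructor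
  · rintro h _ - j hj rfl
    exact h j hj
  · exact fun h j hj => h (a j) ⟨j, hj, rfl⟩ j hj rfl

lemma prod_siteWeight (a : ℕ → ℤ) (n : ℕ) (ω : CookieEnv) :
    ∏ z ∈ (Finset.range n).image a, siteWeight a n z (ω z)
      = ∏ j ∈ Finset.range n, stepWeight (ω (a j) (visits a j (a j))) (a (j + 1) - a j) := by
  rw [← Finset.prod_fiberwise_of_maps_to (t := (Finset.range n).image a) (g := a)
    fun j hj => Finset.mem_image_of_mem a hj]
  refine Finset.prod_congr rfl fun z _ => Finset.prod_congr rfl fun j hj => ?_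
  rw [(Finset.mem_filter.1 hj).2]

/-- The law of the cookies at the site `0`. -/
noncomputable def cookieLaw (P : Measure CookieEnv) : Measure (ℕ → unitInterval) :=
  P.map fun ω => ω 0

instance (P : Measure CookieEnv) [IsProbabilityMeasure P] : IsProbabilityMeasure (cookieLaw P) :=
  Measure.isProbabilityMeasure_map (measurable_pi_apply 0).aemeasurable

lemma CookieIID.arrowLaw_pathEvent {P : Measure CookieEnv} [IsProbabilityMeasure P]
    (hP : CookieIID P) (a : ℕ → ℤ) (n : ℕ) :
    arrowLaw (cookieLaw P) (pathEvent a n) = ∫⁻ ω, ∏ j ∈ Finset.range n,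
      stepWeight (ω (a j) (visits a j (a j))) (a (j + 1) - a j) ∂P := by
  have hsite : ∀ z, stackLaw (cookieLaw P) (siteEvent a n z)
      = ∫⁻ ω, siteWeight a n z (ω z) ∂P := fun z => by
    rw [stackLaw_siteEvent, cookieLaw, ← (hP.2 z).map_eq,
      lintegral_map (measurable_siteWeight a n z) (measurable_pi_apply z)]
  rw [pathEvent_eq_pi, arrowLaw,
    Measure.infinitePi_pi _ fun z _ => measurableSet_siteEvent a n z]
  simp only [hsite, ← prod_siteWeight]
  exact (lintegral_prod_eq_prod_lintegral_of_indepFun _ _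
    (hP.1.comp (siteWeight a n) (measurable_siteWeight a n))
    fun z => (measurable_siteWeight a n z).comp (measurable_pi_apply z)).symm

lemma measure_ext_of_forall_path {S : Type*} [MeasurableSpace S] [Countable S]
    [MeasurableSingletonClass S] {m₁ m₂ : Measure (ℕ → S)} [IsFiniteMeasure m₁]
    (h : ∀ (a : ℕ → S) (n : ℕ), m₁ {w | ∀ i ≤ n, w i = a i} = m₂ {w | ∀ i ≤ n, w i = a i}) :
    m₁ = m₂ := by
  let μ : (I : Finset ℕ) → Measure (I → S) := fun I => m₁.map I.restrict
  have hμ : IsProjectiveMeasureFamily (α := fun _ : ℕ => S) μ := fun I J hJI => by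
    simp only [μ]
    rw [Measure.map_map (Finset.measurable_restrict₂ hJI) (Finset.measurable_restrict I)]
    rfl
  have h₁ : IsProjectiveLimit (α := fun _ : ℕ => S) m₁ μ := fun I => rfl
  have h₂ : IsProjectiveLimit (α := fun _ : ℕ => S) m₂ μ := by
    refine (isProjectiveLimit_nat_iff hμ _).2 fun n => Measure.ext_of_singleton fun b => ?_
    have hpre : (Preorder.frestrictLe n : (ℕ → S) → _) ⁻¹' {b}
        = {w | ∀ i ≤ n, w i = b ⟨min i n, Finset.mem_Iic.2 (min_le_right i n)⟩} := by
      ext w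
      simp only [Set.mem_preimage, Set.mem_singleton_iff, Set.mem_ofPred_eq, funext_iff,
        Subtype.forall, Preorder.frestrictLe_apply, Finset.mem_Iic]
      refine forall₂_congr fun i hi => ?_
      simp only [min_eq_left hi]
    have hm := Preorder.measurable_frestrictLe (X := fun _ : ℕ => S) n
    change m₂.map (Preorder.frestrictLe n) {b} = m₁.map (Preorder.frestrictLe n) {b}
    rw [Measure.map_apply hm (measurableSet_singleton b),
      Measure.map_apply hm (measurableSet_singleton b), hpre, h]
  exact h₁.unique h₂

lemma measureReal_inter_of_condExp_eq {Ω : Type*} {m m₀ : MeasurableSpace Ω} {μ : Measure Ω}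
    [IsFiniteMeasure μ] (hm : m ≤ m₀) {E A : Set Ω} (hE : MeasurableSet[m] E)
    (hA : MeasurableSet[m₀] A) {q : ℝ} (h : ∀ᵐ w ∂μ, w ∈ E → (μ⟦A | m⟧) w = q) :
    μ.real (E ∩ A) = q * μ.real E := calc
  μ.real (E ∩ A) = ∫ w in E, A.indicator (fun _ => (1 : ℝ)) w ∂μ := by
    simp [setIntegral_indicator hA]
  _ = ∫ w in E, (μ⟦A | m⟧) w ∂μ :=
    (setIntegral_condExp hm ((integrable_const 1).indicator hA) hE).symm
  _ = ∫ _ in E, q ∂μ := setIntegral_congr_ae (hm _ hE) h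
  _ = q * μ.real E := by rw [setIntegral_const, smul_eq_mul, mul_comm]

lemma measure_inter_eq_stepWeight_mul {Ω : Type*} [MeasurableSpace Ω] {μ : Measure Ω}
    [IsFiniteMeasure μ] {D : Ω → ℤ} (hD : Measurable D) {E : Set Ω} (hE : MeasurableSet E)
    {p : unitInterval} (hR : μ.real (E ∩ D ⁻¹' {1}) = p * μ.real E)
    (hL : μ.real (E ∩ D ⁻¹' {-1}) = (1 - p) * μ.real E) (d : ℤ) :
    μ (E ∩ D ⁻¹' {d}) = stepWeight p d * μ E := by
  by_cases h1 : d = 1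
  · rw [h1, stepWeight_one, ← ofReal_measureReal, hR, ENNReal.ofReal_mul p.2.1, ofReal_measureReal]
  by_cases h2 : d = -1
  · rw [h2, stepWeight_neg_one, ← ofReal_measureReal, hL, ENNReal.ofReal_mul (sub_nonneg.2 p.2.2),
      ofReal_measureReal]
  have hmR : MeasurableSet (E ∩ D ⁻¹' {1}) := hE.inter (hD (measurableSet_singleton _))
  have hmL : MeasurableSet (E ∩ D ⁻¹' {-1}) := hE.inter (hD (measurableSet_singleton _))
  have hdisj : Disjoint (E ∩ D ⁻¹' {1}) (E ∩ D ⁻¹' {-1}) :=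
    ((Set.disjoint_singleton.2 (by decide)).preimage D).mono Set.inter_subset_right
      Set.inter_subset_right
  have hnull : μ.real (E \ (E ∩ D ⁻¹' {1} ∪ E ∩ D ⁻¹' {-1})) = 0 := by
    rw [measureReal_sdiff (Set.union_subset Set.inter_subset_left Set.inter_subset_left)
      (hmR.union hmL), measureReal_union hdisj hmL, hR, hL]
    ring
  rw [stepWeight_eq_zero p h1 h2, zero_mul]
  refine measure_mono_null ?_ ((measureReal_eq_zero_iff).1 hnull)
  rintro w ⟨hw, rfl⟩
  exact ⟨hw, by simp [h1, h2]⟩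

lemma measurableSet_path {Ω' : Type*} (X : ℕ → Ω' → ℤ) (a : ℕ → ℤ) (n : ℕ) :
    MeasurableSet[pastSigma X n] {w | ∀ i ≤ n, X i w = a i} := by
  simp only [Set.ofPred_forall]
  refine .iInter fun i => .iInter fun hi => ?_
  have hle : MeasurableSpace.comap (X i) inferInstance ≤ pastSigma X n :=
    le_iSup₂_of_le i (Finset.mem_range.2 (Nat.lt_succ_of_le hi)) le_rfl
  exact hle _ ⟨{a i}, measurableSet_singleton _, rfl⟩

lemma priorVisits_eq_visits {Ω' : Type*} (X : ℕ → Ω' → ℤ) (n : ℕ) (w : Ω') :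
    priorVisits X n w = visits (fun i => X i w) n (X n w) :=
  (Nat.count_eq_card_filter_range _ _).symm

namespace IsExcitedRandomWalk

variable {Ω' : Type*} [MeasurableSpace Ω'] {μ : Measure Ω'} {ω : CookieEnv} {x : ℤ}
  {X : ℕ → Ω' → ℤ}

lemma pastSigma_le (hX : IsExcitedRandomWalk μ ω x X) (n : ℕ) :
    pastSigma X n ≤ ‹MeasurableSpace Ω'› :=
  iSup₂_le fun i _ => (hX.measurable i).comap_le

lemma measure_path_succ [IsFiniteMeasure μ] (hX : IsExcitedRandomWalk μ ω x X) (a : ℕ → ℤ)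
    (n : ℕ) : μ {w | ∀ i ≤ n + 1, X i w = a i}
      = stepWeight (ω (a n) (visits a n (a n))) (a (n + 1) - a n)
        * μ {w | ∀ i ≤ n, X i w = a i} := by
  set E := {w | ∀ i ≤ n, X i w = a i} with hEdef
  let D : Ω' → ℤ := fun w => X (n + 1) w - X n w
  have hD : Measurable D := (hX.measurable _).sub (hX.measurable _)
  have hE : MeasurableSet[pastSigma X n] E := measurableSet_path X a n
  have hm := hX.pastSigma_le n
  have hcookie : ∀ w ∈ E, ω (X n w) (priorVisits X n w) = ω (a n) (visits a n (a n)) :=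
    fun w hw => by rw [priorVisits_eq_visits, hw n le_rfl, visits_congr fun i hi => hw i hi.le]
  have hR : {w | X (n + 1) w = X n w + 1} = D ⁻¹' {1} := by
    ext w
    exact sub_eq_iff_eq_add'.symm
  have hL : {w | X (n + 1) w = X n w - 1} = D ⁻¹' {-1} := by
    ext w
    exact sub_eq_iff_eq_add'.symm
  have hsplit : {w | ∀ i ≤ n + 1, X i w = a i} = E ∩ D ⁻¹' {a (n + 1) - a n} := by
    ext w
    simp only [Nat.le_succ_iff_eq_or_le, forall_eq_or_imp, hEdef, Set.mem_inter_iff,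
      Set.mem_ofPred_eq, Set.mem_preimage, Set.mem_singleton_iff, D]
    rw [and_comm]
    exact and_congr_right fun hw => by rw [hw n le_rfl, sub_left_inj]
  rw [hsplit]
  refine measure_inter_eq_stepWeight_mul hD (hm _ hE) ?_ ?_ _
  · refine measureReal_inter_of_condExp_eq hm hE (hD (measurableSet_singleton _)) ?_
    filter_upwards [hX.step_right n] with w hw hwE
    rw [← hR, hw, hcookie w hwE]
  · refine measureReal_inter_of_condExp_eq hm hE (hD (measurableSet_singleton _)) ?_
    filter_upwards [hX.step_left n] with w hw hwE
    rw [← hL, hw, hcookie w hwE]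

lemma measure_path [IsProbabilityMeasure μ] (hX : IsExcitedRandomWalk μ ω x X) (a : ℕ → ℤ)
    (n : ℕ) : μ {w | ∀ i ≤ n, X i w = a i} = if a 0 = x then
      ∏ j ∈ Finset.range n, stepWeight (ω (a j) (visits a j (a j))) (a (j + 1) - a j) else 0 := by
  induction n with
  | zero =>
    have hstart : μ {w | ∀ i ≤ 0, X i w = a i} = μ {_w | a 0 = x} := by
      refine measure_congr (hX.start.mono fun w hw => propext ?_)
      change (∀ i ≤ 0, X i w = a i) ↔ a 0 = x
      simp [hw, eq_comm]
    rw [hstart]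
    split_ifs with h <;> simp [h]
  | succ n ih =>
    rw [hX.measure_path_succ, ih, mul_ite, mul_zero, Finset.prod_range_succ, mul_comm]

end IsExcitedRandomWalk

lemma measurable_averaged_path {Ω' : Type*} [MeasurableSpace Ω'] {κ : Kernel CookieEnv Ω'} {x : ℤ}
    {X : ℕ → Ω' → ℤ} (hX : ∀ ω, IsExcitedRandomWalk (κ ω) ω x X) :
    Measurable fun (p : CookieEnv × Ω') n => X n p.2 :=
  measurable_pi_iff.2 fun n => ((hX fun _ _ => 0).measurable n).comp measurable_snd

lemma CookieIID.map_compProd_eq_map_arrowLaw {P : Measure CookieEnv} [IsProbabilityMeasure P]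
    (hP : CookieIID P) {Ω' : Type*} [MeasurableSpace Ω'] {κ : Kernel CookieEnv Ω'}
    [IsMarkovKernel κ] {x : ℤ} {X : ℕ → Ω' → ℤ} (hX : ∀ ω, IsExcitedRandomWalk (κ ω) ω x X) :
    (P ⊗ₘ κ).map (fun p n => X n p.2) = (arrowLaw (cookieLaw P)).map (stackWalk x) := by
  have hXm := measurable_averaged_path hX
  refine measure_ext_of_forall_path fun a n => ?_
  have hset : MeasurableSet {w : ℕ → ℤ | ∀ i ≤ n, w i = a i} := by
    simp only [Set.ofPred_forall]
    exact .iInter fun i => .iInter fun _ => measurable_pi_apply i (measurableSet_singleton _)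
  have hwalk : stackWalk x ⁻¹' {w | ∀ i ≤ n, w i = a i} = {η | a 0 = x ∧ η ∈ pathEvent a n} := by
    ext η
    exact stackWalk_eq_iff x η a n
  rw [Measure.map_apply hXm hset, Measure.map_apply (measurable_stackWalk x) hset,
    Measure.compProd_apply (hXm hset), hwalk]
  calc ∫⁻ ω, κ ω {w | ∀ i ≤ n, X i w = a i} ∂P
      = ∫⁻ ω, (if a 0 = x then ∏ j ∈ Finset.range n,
          stepWeight (ω (a j) (visits a j (a j))) (a (j + 1) - a j) else 0) ∂P :=
        lintegral_congr fun ω => (hX ω).measure_path a n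
    _ = arrowLaw (cookieLaw P) {η | a 0 = x ∧ η ∈ pathEvent a n} := by
        by_cases h0 : a 0 = x
        · simpa [h0] using (hP.arrowLaw_pathEvent a n).symm
        · simp [h0]

lemma measurableSet_tendsto_path (l : Filter ℤ) [l.IsCountablyGenerated]
    [l.IsMeasurablyGenerated] : MeasurableSet {w : ℕ → ℤ | Tendsto w atTop l} :=
  measurableSet_tendsto l measurable_pi_apply

lemma measurableSet_frequently_eq (x : ℤ) :
    MeasurableSet {w : ℕ → ℤ | ∃ᶠ n in atTop, w n = x} := by
  simp only [frequently_atTop, Set.ofPred_forall, Set.ofPred_exists]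
  exact .iInter fun N => .iUnion fun n => (MeasurableSet.const _).inter
    (measurableSet_eq_fun (measurable_pi_apply n) measurable_const)

lemma measurableSet_forall_ge_eq_half (M : ℕ) :
    MeasurableSet {p : ℕ → unitInterval | ∀ i, M ≤ i → (p i : ℝ) = 1 / 2} := by
  simp only [Set.ofPred_forall]
  exact .iInter fun i => .iInter fun _ => measurableSet_eq_fun
    (measurable_subtype_coe.comp (measurable_pi_apply i)) measurable_const

lemma measurable_sum_two_mul_sub_one (M : ℕ) :
    Measurable fun p : ℕ → unitInterval => ∑ i ∈ Finset.range M, (2 * (p i : ℝ) - 1) :=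
  Finset.measurable_sum _ fun i _ =>
    ((measurable_subtype_coe.comp (measurable_pi_apply i)).const_mul 2).sub_const 1

namespace CookieBD

variable {P : Measure CookieEnv} {M : ℕ}

lemma ae_cookieLaw (hBD : CookieBD M P) :
    ∀ᵐ p ∂cookieLaw P, ∀ i, M ≤ i → (p i : ℝ) = 1 / 2 :=
  (ae_map_iff (measurable_pi_apply 0).aemeasurable (measurableSet_forall_ge_eq_half M)).2
    (hBD.mono fun _ hω => hω 0)

lemma integral_cookieLaw (hBD : CookieBD M P) :
    ∫ p, ∑ i ∈ Finset.range M, (2 * (p i : ℝ) - 1) ∂cookieLaw P = cookieDrift P := by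
  rw [cookieLaw, integral_map (measurable_pi_apply 0).aemeasurable
    (measurable_sum_two_mul_sub_one M).aestronglyMeasurable]
  refine integral_congr_ae ?_
  filter_upwards [hBD] with ω hω
  refine (tsum_eq_sum fun i hi => ?_).symm
  rw [hω 0 i (by simpa using hi)]
  norm_num

end CookieBD

section OneSided

variable {P : Measure CookieEnv} [IsProbabilityMeasure P] {M : ℕ} {Ω' : Type*}
  [MeasurableSpace Ω'] {κ : Kernel CookieEnv Ω'} [IsMarkovKernel κ] {x : ℤ} {X : ℕ → Ω' → ℤ}

lemma ae_of_ae_arrowLaw (hIID : CookieIID P) (hX : ∀ ω, IsExcitedRandomWalk (κ ω) ω x X)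
    {C : (ℕ → ℤ) → Prop} (hC : MeasurableSet {w | C w})
    (h : ∀ᵐ η ∂arrowLaw (cookieLaw P), C (stackWalk x η)) :
    ∀ᵐ p ∂(P ⊗ₘ κ), C fun n => X n p.2 := by
  refine ae_of_ae_map (measurable_averaged_path hX).aemeasurable (p := C) ?_
  rwa [hIID.map_compProd_eq_map_arrowLaw hX, ae_map_iff (measurable_stackWalk x).aemeasurable hC]

lemma ae_frequently_eq_or_tendsto (hIID : CookieIID P) (hBD : CookieBD M P)
    (hX : ∀ ω, IsExcitedRandomWalk (κ ω) ω x X) :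
    ∀ᵐ p ∂(P ⊗ₘ κ), (∃ᶠ n in atTop, X n p.2 = x) ∨ Tendsto (fun n => X n p.2) atTop atTop ∨
      Tendsto (fun n => X n p.2) atTop atBot := by
  refine ae_of_ae_arrowLaw hIID hX (C := fun w => (∃ᶠ n in atTop, w n = x) ∨
    Tendsto w atTop atTop ∨ Tendsto w atTop atBot) ((measurableSet_frequently_eq x).union
      ((measurableSet_tendsto_path _).union (measurableSet_tendsto_path _))) ?_
  filter_upwards [ae_goodStack_arrowLaw hBD.ae_cookieLaw] with η hη
  exact (isStackWalk_stackWalk η x).frequently_eq_or_tendsto hη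

lemma iIndepFun_arrowLaw_right (ρ : Measure (ℕ → unitInterval)) [IsProbabilityMeasure ρ] (x : ℤ) :
    iIndepFun (fun (k : ℕ) (η : ℤ → ℕ → Bool) => η (x + (k + 1 : ℕ))) (arrowLaw ρ) :=
  (iIndepFun_arrowLaw ρ).precomp (g := fun k : ℕ => x + (k + 1 : ℕ)) fun k l hkl => by
    simpa using hkl

lemma ae_not_tendsto_atTop_of_lt_one (hIID : CookieIID P) (hWEL : CookieWEL P)
    (hBD : CookieBD M P) (hX : ∀ ω, IsExcitedRandomWalk (κ ω) ω x X) (hδ : cookieDrift P < 1) :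
    ∀ᵐ p ∂(P ⊗ₘ κ), ¬ Tendsto (fun n => X n p.2) atTop atTop := by
  refine ae_of_ae_arrowLaw hIID hX (C := fun w => ¬ Tendsto w atTop atTop)
    (measurableSet_tendsto_path _).compl ?_
  have hell : 0 < cookieLaw P {p | ∀ i, (p i : ℝ) < 1} :=
    (hWEL 0).2.trans_le (Measure.le_map_apply (measurable_pi_apply 0).aemeasurable _)
  have hextinct := ae_all_iff.2 fun m => ae_exists_branching_eq_zero_of_drift_lt_one
    hBD.ae_cookieLaw hell (hBD.integral_cookieLaw ▸ hδ) (iIndepFun_arrowLaw_right (cookieLaw P) x)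
    (fun k => measurable_pi_apply _) (fun k => arrowLaw_map_eval _ _) m
  filter_upwards [ae_goodStack_arrowLaw hBD.ae_cookieLaw, hextinct] with η hη hzero hlim
  obtain ⟨m, hm⟩ := (isStackWalk_stackWalk η x).exists_branching_pos_of_tendsto_atTop hη hlim
  obtain ⟨k, hk⟩ := hzero m
  exact (hm k).ne' hk

lemma ae_not_frequently_eq_of_one_lt (hIID : CookieIID P) (hBD : CookieBD M P)
    (hX : ∀ ω, IsExcitedRandomWalk (κ ω) ω x X) (hδ : 1 < cookieDrift P) :
    ∀ᵐ p ∂(P ⊗ₘ κ), ¬ ∃ᶠ n in atTop, X n p.2 = x := by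
  refine ae_of_ae_arrowLaw hIID hX (C := fun w => ¬ ∃ᶠ n in atTop, w n = x)
    (measurableSet_frequently_eq x).compl ?_
  have hsurvive := ae_exists_forall_branching_ne_zero_of_one_lt_drift hBD.ae_cookieLaw
    (hBD.integral_cookieLaw ▸ hδ) (iIndepFun_arrowLaw_right (cookieLaw P) x)
    (fun k => measurable_pi_apply _) (fun k => arrowLaw_map_eval _ _)
  filter_upwards [ae_goodStack_arrowLaw hBD.ae_cookieLaw, hsurvive] with η hη ⟨m, hm⟩ hrec
  obtain ⟨k, hk⟩ :=
    (isStackWalk_stackWalk η x).exists_branching_eq_zero_of_frequently_eq (hη x) hrec m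
  exact hm k hk

end OneSided

/-! ### Reflection -/

/-- The stack of cookies seen in a mirror. -/
def mirrorStack (p : ℕ → unitInterval) (i : ℕ) : unitInterval := unitInterval.symm (p i)

/-- The cookie environment seen in a mirror: it is the environment of the walk `-X`. -/
def mirrorEnv (ω : CookieEnv) (z : ℤ) : ℕ → unitInterval := mirrorStack (ω (-z))

lemma mirrorEnv_mirrorEnv (ω : CookieEnv) : mirrorEnv (mirrorEnv ω) = ω := by
  funext z i
  simp [mirrorEnv, mirrorStack]

lemma measurable_mirrorStack : Measurable mirrorStack :=
  measurable_pi_iff.2 fun i => unitInterval.continuous_symm.measurable.comp (measurable_pi_apply i)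

lemma measurable_mirrorEnv : Measurable mirrorEnv :=
  measurable_pi_iff.2 fun z => measurable_mirrorStack.comp (measurable_pi_apply (-z))

section Mirror

variable {P : Measure CookieEnv} {M : ℕ}

instance [IsProbabilityMeasure P] : IsProbabilityMeasure (P.map mirrorEnv) :=
  Measure.isProbabilityMeasure_map measurable_mirrorEnv.aemeasurable

lemma CookieIID.mirror (h : CookieIID P) : CookieIID (P.map mirrorEnv) := by
  have hind : iIndepFun (fun z ω => mirrorEnv ω z) P :=
    (h.1.precomp (g := fun z : ℤ => -z) neg_injective).comp (fun _ => mirrorStack)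
      fun _ => measurable_mirrorStack
  have hsite : ∀ z : ℤ, (P.map mirrorEnv).map (fun ω => ω z) = (cookieLaw P).map mirrorStack :=
    fun z => by
      rw [Measure.map_map (measurable_pi_apply z) measurable_mirrorEnv, cookieLaw,
        ← (h.2 (-z)).map_eq, Measure.map_map measurable_mirrorStack (measurable_pi_apply _)]
      rfl
  have := h.1.isProbabilityMeasure
  refine ⟨?_, fun z => ⟨(measurable_pi_apply z).aemeasurable, (measurable_pi_apply 0).aemeasurable,
    (hsite z).trans (hsite 0).symm⟩⟩
  rw [iIndepFun_iff_map_fun_eq_infinitePi_map measurable_pi_apply, Measure.map_id']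
  refine (hind.map_fun_eq_infinitePi_map fun z =>
    (measurable_pi_apply z).comp measurable_mirrorEnv).trans (congrArg _ (funext fun z => ?_))
  exact (Measure.map_map (measurable_pi_apply z) measurable_mirrorEnv).symm

lemma CookieWEL.mirror (h : CookieWEL P) : CookieWEL (P.map mirrorEnv) := by
  intro z
  have hle := Measure.le_map_apply (μ := P) measurable_mirrorEnv.aemeasurable
  have hpos : {ω : CookieEnv | ∀ i, (ω (-z) i : ℝ) < 1}
      = mirrorEnv ⁻¹' {ω | ∀ i, 0 < (ω z i : ℝ)} := by
    ext ω
    simp only [mirrorEnv, mirrorStack, Set.mem_ofPred_eq, Set.mem_preimage,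
      unitInterval.coe_symm_eq, sub_pos]
  have hlt : {ω : CookieEnv | ∀ i, 0 < (ω (-z) i : ℝ)}
      = mirrorEnv ⁻¹' {ω | ∀ i, (ω z i : ℝ) < 1} := by
    ext ω
    simp only [mirrorEnv, mirrorStack, Set.mem_ofPred_eq, Set.mem_preimage,
      unitInterval.coe_symm_eq, sub_lt_self_iff]
  exact ⟨(hpos ▸ (h (-z)).2).trans_le (hle _), (hlt ▸ (h (-z)).1).trans_le (hle _)⟩

lemma CookieBD.mirror (h : CookieBD M P) : CookieBD M (P.map mirrorEnv) := by
  have hset : MeasurableSet {ω : CookieEnv | ∀ z : ℤ, ∀ i, M ≤ i → (ω z i : ℝ) = 1 / 2} := by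
    rw [Set.ofPred_forall]
    exact .iInter fun z =>
      (measurable_pi_apply (X := fun _ : ℤ => ℕ → unitInterval) z)
        (measurableSet_forall_ge_eq_half M)
  rw [CookieBD, ae_map_iff measurable_mirrorEnv.aemeasurable hset]
  filter_upwards [h] with ω hω z i hi
  rw [mirrorEnv, mirrorStack, unitInterval.coe_symm_eq, hω (-z) i hi]
  norm_num

lemma cookieDrift_mirror : cookieDrift (P.map mirrorEnv) = -cookieDrift P := by
  have hm : Measurable fun ω : CookieEnv => ∑' i : ℕ, (2 * (ω 0 i : ℝ) - 1) := by fun_prop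
  rw [cookieDrift, integral_map measurable_mirrorEnv.aemeasurable hm.aestronglyMeasurable,
    cookieDrift, ← integral_neg]
  refine integral_congr_ae (ae_of_all _ fun ω => ?_)
  simp only [mirrorEnv, mirrorStack, neg_zero, unitInterval.coe_symm_eq, ← tsum_neg]
  exact tsum_congr fun i => by ring

end Mirror

lemma pastSigma_neg {Ω' : Type*} (X : ℕ → Ω' → ℤ) (n : ℕ) :
    pastSigma (fun n w => -X n w) n = pastSigma X n := by
  unfold pastSigma
  refine iSup_congr fun i => iSup_congr fun _ => ?_
  exact MeasurableSpace.comap_comp.symm.trans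
    (congrArg _ (MeasurableEquiv.neg ℤ).measurableEmbedding.comap_eq)

lemma IsExcitedRandomWalk.mirror {Ω' : Type*} [MeasurableSpace Ω'] {μ : Measure Ω'}
    {ω : CookieEnv} {x : ℤ} {X : ℕ → Ω' → ℤ} (h : IsExcitedRandomWalk μ (mirrorEnv ω) x X) :
    IsExcitedRandomWalk μ ω (-x) fun n w => -X n w where
  measurable n := (h.measurable n).neg
  start := h.start.mono fun w hw => congrArg Neg.neg hw
  step_right n := by
    have hset : {w | -X (n + 1) w = -X n w + 1} = {w | X (n + 1) w = X n w - 1} := by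
      ext w
      simp only [Set.mem_ofPred_eq]
      omega
    rw [hset, pastSigma_neg]
    filter_upwards [h.step_left n] with w hw
    rw [hw]
    simp [mirrorEnv, mirrorStack, priorVisits]
  step_left n := by
    have hset : {w | -X (n + 1) w = -X n w - 1} = {w | X (n + 1) w = X n w + 1} := by
      ext w
      simp only [Set.mem_ofPred_eq]
      omega
    rw [hset, pastSigma_neg]
    filter_upwards [h.step_right n] with w hw
    rw [hw]
    simp [mirrorEnv, mirrorStack, priorVisits]

section MirroredWalk

variable {P : Measure CookieEnv} [IsProbabilityMeasure P] {M : ℕ} {Ω' : Type*}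
  [MeasurableSpace Ω'] {κ : Kernel CookieEnv Ω'} [IsMarkovKernel κ] {x : ℤ} {X : ℕ → Ω' → ℤ}

lemma ae_of_ae_mirror (hX : ∀ ω, IsExcitedRandomWalk (κ ω) ω x X) {C : (ℕ → ℤ) → Prop}
    (hC : MeasurableSet {w | C w})
    (h : ∀ᵐ p ∂(P.map mirrorEnv ⊗ₘ κ.comap mirrorEnv measurable_mirrorEnv), C fun n => X n p.2) :
    ∀ᵐ p ∂(P ⊗ₘ κ), C fun n => X n p.2 := by
  refine Measure.ae_compProd_of_ae_ae (measurable_averaged_path hX hC) ?_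
  filter_upwards [ae_of_ae_map measurable_mirrorEnv.aemeasurable
    (Measure.ae_ae_of_ae_compProd h)] with ω hω
  rwa [Kernel.comap_apply, mirrorEnv_mirrorEnv] at hω

lemma ae_not_tendsto_atBot_of_neg_one_lt (hIID : CookieIID P) (hWEL : CookieWEL P)
    (hBD : CookieBD M P) (hX : ∀ ω, IsExcitedRandomWalk (κ ω) ω x X) (hδ : -1 < cookieDrift P) :
    ∀ᵐ p ∂(P ⊗ₘ κ), ¬ Tendsto (fun n => X n p.2) atTop atBot := by
  refine ae_of_ae_mirror hX (C := fun w => ¬ Tendsto w atTop atBot)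
    (measurableSet_tendsto_path _).compl ?_
  filter_upwards [ae_not_tendsto_atTop_of_lt_one hIID.mirror hWEL.mirror hBD.mirror
    (κ := κ.comap mirrorEnv measurable_mirrorEnv) (fun ω => (hX (mirrorEnv ω)).mirror)
    (by rw [cookieDrift_mirror]; linarith)] with p hp hlim
  exact hp (tendsto_neg_atBot_atTop.comp hlim)

lemma ae_not_frequently_eq_of_lt_neg_one (hIID : CookieIID P) (hBD : CookieBD M P)
    (hX : ∀ ω, IsExcitedRandomWalk (κ ω) ω x X) (hδ : cookieDrift P < -1) :
    ∀ᵐ p ∂(P ⊗ₘ κ), ¬ ∃ᶠ n in atTop, X n p.2 = x := by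
  refine ae_of_ae_mirror hX (C := fun w => ¬ ∃ᶠ n in atTop, w n = x)
    (measurableSet_frequently_eq x).compl ?_
  filter_upwards [ae_not_frequently_eq_of_one_lt hIID.mirror hBD.mirror
    (κ := κ.comap mirrorEnv measurable_mirrorEnv) (fun ω => (hX (mirrorEnv ω)).mirror)
    (by rw [cookieDrift_mirror]; linarith)] with p hp
  simpa only [neg_inj] using hp

end MirroredWalk

/-- `κ ω` is the quenched measure in the environment `ω`, and `P ⊗ₘ κ` is the averaged measure. -/
theorem mainTheorem7 (P : Measure CookieEnv) [IsProbabilityMeasure P] (M : ℕ)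
    (hIID : CookieIID P) (hWEL : CookieWEL P) (hBD : CookieBD M P)
    {Ω' : Type*} [MeasurableSpace Ω'] (κ : Kernel CookieEnv Ω') [IsMarkovKernel κ]
    (x : ℤ) (X : ℕ → Ω' → ℤ) (hX : ∀ ω, IsExcitedRandomWalk (κ ω) ω x X) :
    (|cookieDrift P| < 1 → ∀ᵐ p ∂(P ⊗ₘ κ), ∃ᶠ n in atTop, X n p.2 = x) ∧
    (1 < cookieDrift P → ∀ᵐ p ∂(P ⊗ₘ κ), Tendsto (fun n => X n p.2) atTop atTop) ∧
    (cookieDrift P < -1 → ∀ᵐ p ∂(P ⊗ₘ κ), Tendsto (fun n => X n p.2) atTop atBot) := by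
  have htri := ae_frequently_eq_or_tendsto hIID hBD hX
  refine ⟨fun hδ => ?_, fun hδ => ?_, fun hδ => ?_⟩
  · obtain ⟨h1, h2⟩ := abs_lt.1 hδ
    filter_upwards [htri, ae_not_tendsto_atTop_of_lt_one hIID hWEL hBD hX h2,
      ae_not_tendsto_atBot_of_neg_one_lt hIID hWEL hBD hX h1] with p hp hp1 hp2
    exact hp.resolve_right (not_or.2 ⟨hp1, hp2⟩)
  · filter_upwards [htri, ae_not_frequently_eq_of_one_lt hIID hBD hX hδ,
      ae_not_tendsto_atBot_of_neg_one_lt hIID hWEL hBD hX (by linarith)] with p hp hp1 hp2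
    exact (hp.resolve_left hp1).resolve_right hp2
  · filter_upwards [htri, ae_not_frequently_eq_of_lt_neg_one hIID hBD hX hδ,
      ae_not_tendsto_atTop_of_lt_one hIID hWEL hBD hX (by linarith)] with p hp hp1 hp2
    exact (hp.resolve_left hp1).resolve_left hp2
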